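/- Rings are unital and associative, and modules are left modules unless said otherwise. For a ring $A$ and a left (resp. right) $A$-module $M$, the grade is $j(M)=\inf\{i\ge 0 : \operatorname{Ext}^i_A(M,A)\neq 0\}$ (with $\inf\emptyset=+\infty$), where $A$ is regarded as a left (resp. right) $A$-module. A ring $A$ satisfies the Auslander condition if $j(N)\ge i$ for every Noetherian left $A$-module $M$, every $i\ge 0$ and every right $A$-submodule $N\subseteq \operatorname{Ext}^i_A(M,A)$. It is Auslander regular if it is left Noetherian, satisfies the Auslander condition, and has finite left injective dimension and finite global dimension. Let $R$ be a Noetherian commutative ring, and let $A$ be a ring that contains $R$ as a central subring and is a finitely generated $R$-module. Let $A_X$ be the sheaf of $\mathcal O_X$-algebras on $X=\operatorname{Spec}(R)$ associated to $A$. Consider the following conditions. 1. $A$ is Auslander regular. 2. There is an affine open covering $\{U_i\}$ of $\operatorname{Spec}(R)$ such that each ring $\Gamma(U_i,A_X)$ is Auslander regular. 3. There are finitely many elements $f_1,\dots,f_t\in R$ whose zero locus $V(f_1,\dots,f_t)\subseteq\operatorname{Spec}(R)$ is empty such that each localization $A[f_j^{-1}]$ is Auslander regular. 4. For every prime ideal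 $\mathfrak p$ of $R$, the ring $A\otimes_R R_{\mathfrak p}$ is Auslander regular. 5. For every maximal ideal $\mathfrak m$ of $R$, the ring $A\otimes_R R_{\mathfrak m}$ is Auslander regular. Then (1), (2) and (3) are equivalent, and they imply (4). If $R$ has finite Krull dimension, then (4) implies (1), so that (1)–(4) are equivalent. If $R$ is a finitely generated commutative algebra over a field $\mathbb k$, then (1)–(5) are equivalent. -/

import Mathlib

open CategoryTheory CategoryTheory.Abelian AlgebraicGeometry
open TopologicalSpace TensorProduct

universe u v

noncomputable section

namespace AuslanderTheory

/-- The group `Ext^i_A(M, A)` of a left `A`-module `M`. It is a type of its own so that it can carry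
the right `A`-module structure below and no other one. -/
def ExtToRing (A : Type u) [Ring A] (M : ModuleCat.{u} A) (i : ℕ) : Type u :=
  Ext M (ModuleCat.of A A) i

instance (A : Type u) [Ring A] (M : ModuleCat.{u} A) (i : ℕ) : AddCommGroup (ExtToRing A M i) :=
  inferInstanceAs (AddCommGroup (Ext M (ModuleCat.of A A) i))

/-- Right multiplication `x ↦ x * a`, an endomorphism of the left `A`-module `A`. -/
def rightMul {A : Type u} [Ring A] (a : A) : ModuleCat.of A A ⟶ ModuleCat.of A A :=
  ModuleCat.ofHom (LinearMap.toSpanSingleton A A a)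

theorem rightMul_one (A : Type u) [Ring A] : rightMul (1 : A) = 𝟙 (ModuleCat.of A A) := by
  ext; simp [rightMul]

theorem rightMul_mul {A : Type u} [Ring A] (a b : A) :
    rightMul (a * b) = rightMul a ≫ rightMul b := by
  ext; simp [rightMul]

theorem rightMul_add {A : Type u} [Ring A] (a b : A) :
    rightMul (a + b) = rightMul a + rightMul b := by
  ext; simp [rightMul]

theorem rightMul_zero (A : Type u) [Ring A] : rightMul (0 : A) = 0 := by
  ext; simp [rightMul]

/-- The right action of `a` on `Ext^i_A(M, A)`, induced by the endomorphism `x ↦ x * a` of `A`. -/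
def extRightMul {A : Type u} [Ring A] {M : ModuleCat.{u} A} {i : ℕ} (a : A)
    (x : Ext M (ModuleCat.of A A) i) : Ext M (ModuleCat.of A A) i :=
  x.comp (Ext.mk₀ (rightMul a)) (add_zero i)

theorem extRightMul_one {A : Type u} [Ring A] {M : ModuleCat.{u} A} {i : ℕ}
    (x : Ext M (ModuleCat.of A A) i) : extRightMul 1 x = x := by
  rw [extRightMul, rightMul_one, Ext.comp_mk₀_id]

theorem extRightMul_mul {A : Type u} [Ring A] {M : ModuleCat.{u} A} {i : ℕ} (a b : A)
    (x : Ext M (ModuleCat.of A A) i) :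
    extRightMul (a * b) x = extRightMul b (extRightMul a x) := by
  simp only [extRightMul, rightMul_mul, ← Ext.mk₀_comp_mk₀, Ext.comp_assoc_of_third_deg_zero]

theorem extRightMul_zero {A : Type u} [Ring A] {M : ModuleCat.{u} A} {i : ℕ} (a : A) :
    extRightMul a (0 : Ext M (ModuleCat.of A A) i) = 0 := by
  rw [extRightMul, Ext.zero_comp]

theorem extRightMul_add {A : Type u} [Ring A] {M : ModuleCat.{u} A} {i : ℕ} (a : A)
    (x y : Ext M (ModuleCat.of A A) i) :
    extRightMul a (x + y) = extRightMul a x + extRightMul a y := by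
  rw [extRightMul, Ext.add_comp]; rfl

theorem add_extRightMul {A : Type u} [Ring A] {M : ModuleCat.{u} A} {i : ℕ} (a b : A)
    (x : Ext M (ModuleCat.of A A) i) :
    extRightMul (a + b) x = extRightMul a x + extRightMul b x := by
  rw [extRightMul, rightMul_add, Ext.mk₀_add, Ext.comp_add]; rfl

theorem zero_extRightMul {A : Type u} [Ring A] {M : ModuleCat.{u} A} {i : ℕ}
    (x : Ext M (ModuleCat.of A A) i) : extRightMul (0 : A) x = 0 := by
  rw [extRightMul, rightMul_zero, Ext.mk₀_zero, Ext.comp_zero]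

/-- `Ext^i_A(M, A)` is a right `A`-module, that is, a left module over the opposite ring. -/
instance (A : Type u) [Ring A] (M : ModuleCat.{u} A) (i : ℕ) : Module Aᵐᵒᵖ (ExtToRing A M i) where
  smul a x := extRightMul (M := M) (i := i) a.unop x
  one_smul x := extRightMul_one (M := M) (i := i) x
  mul_smul a b x := extRightMul_mul (M := M) (i := i) b.unop a.unop x
  smul_zero a := extRightMul_zero (M := M) (i := i) a.unop
  smul_add a x y := extRightMul_add (M := M) (i := i) a.unop x y
  add_smul a b x := add_extRightMul (M := M) (i := i) a.unop b.unop x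
  zero_smul x := zero_extRightMul (M := M) (i := i) x

/-- The grade `j(M) = inf {i | Ext^i_A(M, A) ≠ 0}` of a left `A`-module, with `inf ∅ = ∞`. The grade
of a right `A`-module is its grade as a left module over `Aᵐᵒᵖ`. -/
def grade (A : Type u) [Ring A] (M : ModuleCat.{u} A) : ℕ∞ :=
  ⨅ (i : ℕ) (_ : Nontrivial (ExtToRing A M i)), (i : ℕ∞)

/-- The Auslander condition: `j(N) ≥ i` for every Noetherian left `A`-module `M`, every `i ≥ 0` and
every right `A`-submodule `N` of `Ext^i_A(M, A)`. -/
def AuslanderCondition (A : Type u) [Ring A] : Prop :=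
  ∀ (M : ModuleCat.{u} A), IsNoetherian A M → ∀ (i : ℕ) (N : Submodule Aᵐᵒᵖ (ExtToRing A M i)),
    (i : ℕ∞) ≤ grade Aᵐᵒᵖ (ModuleCat.of Aᵐᵒᵖ N)

/-- Auslander-Gorenstein rings: left Noetherian, with the Auslander condition and of finite left
injective dimension. -/
structure IsAuslanderGorenstein (A : Type u) [Ring A] : Prop where
  isNoetherianRing : IsNoetherianRing A
  auslanderCondition : AuslanderCondition A
  finite_injectiveDimension : ∃ n : ℕ, HasInjectiveDimensionLE (ModuleCat.of A A) n

/-- Auslander regular rings: Auslander-Gorenstein rings of finite (left) global dimension. -/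
structure IsAuslanderRegular (A : Type u) [Ring A] : Prop extends IsAuslanderGorenstein A where
  finite_globalDimension : ∃ n : ℕ, ∀ M : ModuleCat.{u} A, HasProjectiveDimensionLE M n

/-- The ring `Γ(U, A_X)` of sections over `U ⊆ X = Spec R` of the sheaf of `𝒪_X`-algebras associated
to an `R`-algebra `A`: the families `(s(𝔭))` with `s(𝔭) ∈ A_𝔭` for `𝔭 ∈ U` that are locally of the
form `a / f` with `a ∈ A` and `f ∈ R`. The algebra `A` need not be commutative. -/
def sheafSections (R A : Type u) [CommRing R] [Ring A] [Algebra R A]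
    (U : Opens (PrimeSpectrum R)) :
    Subalgebra R (Π p : U, LocalizedModule p.1.asIdeal.primeCompl A) where
  carrier := {s | ∀ p : U, ∃ V : Opens (PrimeSpectrum R), p.1 ∈ V ∧ V ≤ U ∧
    ∃ (a : A) (f : R), ∀ q : U, q.1 ∈ V →
      ∃ hf : f ∈ q.1.asIdeal.primeCompl, s q = LocalizedModule.mk a ⟨f, hf⟩}
  add_mem' {s t} hs ht p := by
    obtain ⟨V, hV, hVU, a, f, h⟩ := hs p
    obtain ⟨W, hW, -, b, g, k⟩ := ht p
    refine ⟨V ⊓ W, ⟨hV, hW⟩, inf_le_left.trans hVU, g • a + f • b, f * g, fun q hq ↦ ?_⟩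
    obtain ⟨hf, h⟩ := h q hq.1
    obtain ⟨hg, k⟩ := k q hq.2
    exact ⟨mul_mem hf hg, congr($h + $k).trans (LocalizedModule.mk_add_mk ..)⟩
  mul_mem' {s t} hs ht p := by
    obtain ⟨V, hV, hVU, a, f, h⟩ := hs p
    obtain ⟨W, hW, -, b, g, k⟩ := ht p
    refine ⟨V ⊓ W, ⟨hV, hW⟩, inf_le_left.trans hVU, a * b, f * g, fun q hq ↦ ?_⟩
    obtain ⟨hf, h⟩ := h q hq.1
    obtain ⟨hg, k⟩ := k q hq.2
    exact ⟨mul_mem hf hg, congr($h * $k).trans (LocalizedModule.mk_mul_mk ..)⟩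
  algebraMap_mem' r p :=
    ⟨U, p.2, le_rfl, algebraMap R A r, 1, fun q _ ↦ ⟨one_mem _, rfl⟩⟩

end AuslanderTheory

end

/-! For a finite module over a Noetherian ring, Ext into a fixed module commutes with central
localization. The tool is a universal class (`exists_universal_ext`): all classes in Ext^i(M, N)
come from one η in Ext^i(M, K) with K finite, so denominators are cleared for maps out of K,
uniformly in N.

Consequently Ext^i_A(M, A) localizes as a right module (`IsLocMap.exists_extToRing`). Finite modules
and submodules over a localization come from A, so the Auslander condition passes to localizations,
and it descends from any family of them covering Spec R. Finite global dimension also passes to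
localizations, and descends from finite covers by taking the largest bound; it bounds the injective
dimension. This gives the equivalence of (1)–(3), once (2) is refined to basic opens, and (1) ⇒ (4).

The hard point of (4) ⇒ (1) is that the finite global dimensions of the rings A_q are bounded
(`exists_forall_vanishAt`). By Noetherian induction on closed sets it is enough to bound them on a
nonempty open part of V(J), for J prime. The single module W = Hom_R(A, R/J) satisfies Ext^i(W, -) =
0 for some i, by quasi-compactness of Spec R. On an open part of V(J) where A/JA is generically free
over R/J, W can be divided by elements of q regular on the successive quotients R/I. Each division
yields a larger Hom_R(A, R/I) at the cost of one degree, and each shortens the chains of primes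
between I and q, so after at most dim R divisions q is an associated prime of R/I locally at q. Then
every finite module killed by q embeds, locally at q, in a power of Hom_R(A, R/I). If Ext^{s+1}
vanishes at q for all finite modules and i + dim R ≤ s, the long exact sequence makes Ext^s vanish
for modules killed by q; dévissage and Nakayama's lemma extend this to all finite modules.
Descending on s from the bound at q reaches i + dim R, which does not depend on q.

An algebra of finite type over a field has finite Krull dimension, and A_p is a localization of A_m
for p ⊆ m, which brings in (5). -/

noncomputable section

namespace AuslanderTheory

/-! ### Universal Ext classes and tests for global dimension -/

section Homological

variable {A : Type u} [Ring A]

theorem exists_finite_projective_cover (M : Type u) [AddCommGroup M] [Module A M]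
    [Module.Finite A M] : ∃ (P : Type u) (_ : AddCommGroup P) (_ : Module A P)
      (_ : Module.Finite A P) (_ : Module.Projective A P) (f : P →ₗ[A] M),
      Function.Surjective f := by
  obtain ⟨n, f, hf⟩ := Module.Finite.exists_fin' A M
  exact ⟨ULift.{u} (Fin n → A), inferInstance, inferInstance,
    Module.Finite.equiv ULift.moduleEquiv.symm, Module.Projective.of_equiv ULift.moduleEquiv.symm,
    f ∘ₗ ULift.moduleEquiv.toLinearMap, hf.comp ULift.moduleEquiv.surjective⟩

/-- A finite module `M` over a left Noetherian ring has a class `η ∈ Ext^i(M, K)`, with `K` finite,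
through which all classes in all groups `Ext^i(M, N)` factor; and `η ≫ g` vanishes exactly when `g`
extends along a fixed map `j` from `K` to a finite module. -/
theorem exists_universal_ext [IsNoetherianRing A] (i : ℕ) :
    ∀ (M : ModuleCat.{u} A) [Module.Finite A M], ∃ (K F : ModuleCat.{u} A) (j : K ⟶ F)
      (η : Ext M K i), Module.Finite A K ∧ Module.Finite A F ∧ ∀ N : ModuleCat.{u} A,
      (∀ x : Ext M N i, ∃ g : K ⟶ N, η.comp (Ext.mk₀ g) (add_zero i) = x) ∧
      ∀ g : K ⟶ N, η.comp (Ext.mk₀ g) (add_zero i) = 0 ↔ ∃ g' : F ⟶ N, j ≫ g' = g := by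
  induction i with
  | zero =>
    intro M _
    -- In degree 0 the universal class is the identity; F = 0 says that no nonzero map becomes
    -- trivial.
    refine ⟨M, ModuleCat.of A PUnit, 0, Ext.mk₀ (𝟙 M), inferInstance, inferInstance,
      fun N ↦ ⟨fun x ↦ ?_, fun g ↦ ?_⟩⟩
    · obtain ⟨g, rfl⟩ := Ext.homEquiv₀.symm.surjective x
      exact ⟨g, by simp⟩
    · rw [Ext.mk₀_comp_mk₀, Category.id_comp, Ext.mk₀_eq_zero_iff]
      exact ⟨fun h ↦ ⟨0, by simp [h]⟩, fun ⟨g', h⟩ ↦ by rw [← h, Limits.zero_comp]⟩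
  | succ i ih =>
    intro M _
    obtain ⟨P, hPA, hPB, hPF, hPP, f, hf⟩ := exists_finite_projective_cover (A := A) M
    have hS := LinearMap.shortExact_shortComplexKer hf
    have : Projective f.shortComplexKer.X₂ :=
      ModuleCat.projective_of_categoryTheory_projective (ModuleCat.of A P)
    have : Module.Finite A f.shortComplexKer.X₁ :=
      inferInstanceAs (Module.Finite A (LinearMap.ker f))
    have hsurj (N : ModuleCat.{u} A) (x : Ext M N (i + 1)) :=
      Ext.contravariant_sequence_exact₃ hS N x (Ext.eq_zero_of_projective _) (add_comm 1 i)
    -- The connecting map Ext^i(ker f, N) → Ext^{i+1}(M, N) is onto. For i = 0 its kernel consists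
    -- of the maps that extend over P; for i > 0 it is injective, so the pair (K, F) of ker f is
    -- reused.
    obtain _ | i := i
    · refine ⟨f.shortComplexKer.X₁, f.shortComplexKer.X₂, f.shortComplexKer.f, hS.extClass,
        inferInstance, inferInstanceAs (Module.Finite A P), fun N ↦ ⟨fun x ↦ ?_, fun g ↦ ?_⟩⟩
      · obtain ⟨y, rfl⟩ := hsurj N x
        obtain ⟨g, rfl⟩ := Ext.homEquiv₀.symm.surjective y
        exact ⟨g, rfl⟩
      · refine ⟨fun h ↦ ?_, ?_⟩
        · obtain ⟨y, hy⟩ := Ext.contravariant_sequence_exact₁ hS N (Ext.mk₀ g) (add_comm 1 0) h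
          obtain ⟨g', rfl⟩ := Ext.homEquiv₀.symm.surjective y
          exact ⟨g', Ext.homEquiv₀.symm.injective (by simpa using hy)⟩
        · rintro ⟨g', rfl⟩
          rw [← Ext.mk₀_comp_mk₀, ← Ext.comp_assoc_of_third_deg_zero, hS.extClass_comp,
            Ext.zero_comp]
    · obtain ⟨K, F, j, η, hK, hF, h⟩ := ih f.shortComplexKer.X₁
      refine ⟨K, F, j, hS.extClass.comp η (add_comm 1 (i + 1)), hK, hF,
        fun N ↦ ⟨fun x ↦ ?_, fun g ↦ ?_⟩⟩
      · obtain ⟨y, rfl⟩ := hsurj N x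
        obtain ⟨g, rfl⟩ := (h N).1 y
        exact ⟨g, Ext.comp_assoc_of_third_deg_zero _ _ _ _⟩
      · rw [← (h N).2 g, Ext.comp_assoc_of_third_deg_zero]
        refine ⟨fun h0 ↦ ?_, fun h0 ↦ by rw [h0, Ext.comp_zero]⟩
        obtain ⟨y, hy⟩ := Ext.contravariant_sequence_exact₁ hS N _ (add_comm 1 (i + 1)) h0
        rw [← hy, Ext.eq_zero_of_projective y, Ext.comp_zero]

/-- A ring over which `Ext^{n+1}` vanishes on finite modules has global dimension at most `n`. -/
theorem hasProjectiveDimensionLE_of_forall_finite (n : ℕ)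
    (h : ∀ (M : ModuleCat.{u} A) [Module.Finite A M] (Y : ModuleCat.{u} A) (x : Ext M Y (n + 1)),
      x = 0) (M : ModuleCat.{u} A) : HasProjectiveDimensionLE M n := by
  -- With Y fixed, the degree is lowered by cosyzygies of Y, which preserve the hypothesis on finite
  -- modules. In degree 1 the hypothesis for the cyclic modules A/I is Baer's criterion.
  suffices key : ∀ (m : ℕ) (Y : ModuleCat.{u} A), (∀ (M : ModuleCat.{u} A) [Module.Finite A M]
      (x : Ext M Y (m + 1)), x = 0) → ∀ (M : ModuleCat.{u} A) (x : Ext M Y (m + 1)), x = 0 by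
    exact hasProjectiveDimensionLT_of_enoughInjectives M (n + 1) fun Y ↦
      subsingleton_of_forall_eq 0 (key n Y (fun M _ x ↦ h M Y x) M)
  intro m
  induction m with
  | zero =>
    intro Y hY M x
    have : Module.Injective A Y := by
      refine Module.Baer.injective fun I g ↦ ?_
      have hS := LinearMap.shortExact_shortComplexKer (Submodule.mkQ_surjective I)
      let e : LinearMap.ker I.mkQ ≃ₗ[A] I := LinearEquiv.ofEq _ _ (Submodule.ker_mkQ I)
      obtain ⟨y, hy⟩ := Ext.contravariant_sequence_exact₁ hS Y
        (Ext.mk₀ (ModuleCat.ofHom (g ∘ₗ e.toLinearMap))) (add_comm 1 0) (by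
          have : Module.Finite A I.mkQ.shortComplexKer.X₃ :=
            inferInstanceAs (Module.Finite A (A ⧸ I))
          exact hY _ _)
      obtain ⟨g', rfl⟩ := Ext.homEquiv₀.symm.surjective y
      have hy' : I.mkQ.shortComplexKer.f ≫ g' = ModuleCat.ofHom (g ∘ₗ e.toLinearMap) :=
        Ext.homEquiv₀.symm.injective (by simpa using hy)
      exact ⟨g'.hom, fun x hx ↦ congr($hy' ⟨x, by simpa using hx⟩)⟩
    have : Injective Y := Module.injective_object_of_injective_module A Y
    exact x.eq_zero_of_injective
  | succ m ih =>
    intro Y hY M x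
    let I : InjectivePresentation Y := Classical.arbitrary _
    let S := ShortComplex.mk _ _ (Limits.cokernel.condition I.f)
    have hS : S.ShortExact := { exact := ShortComplex.exact_cokernel I.f }
    have : Injective S.X₂ := I.injective
    obtain ⟨y, rfl⟩ := Ext.covariant_sequence_exact₁ M hS x
      (Ext.eq_zero_of_injective (I := S.X₂) _) rfl
    rw [ih S.X₃ (fun M _ z ↦ ?_) M y, Ext.zero_comp]
    obtain ⟨w, rfl⟩ := Ext.covariant_sequence_exact₃ M hS z rfl (hY M _)
    rw [w.eq_zero_of_injective, Ext.zero_comp]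

end Homological

/-! ### Central localization and restriction of scalars -/

section CentralLocalization

variable {R A A' : Type u} [CommRing R] [Ring A] [Algebra R A] [Ring A'] [Algebra R A']

/-- The restriction of scalars along a homomorphism of `R`-algebras. -/
abbrev res (φ : A →ₐ[R] A') : ModuleCat.{u} A' ⥤ ModuleCat.{u} A :=
  ModuleCat.restrictScalars φ.toRingHom

/-- Multiplication by a central element `r`, as an endomorphism of an `A`-module. -/
def centralEnd (r : R) (M : ModuleCat.{u} A) : M ⟶ M :=
  ModuleCat.ofHom
    { toFun x := algebraMap R A r • x
      map_add' x y := smul_add _ x y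
      map_smul' a x := by
        rw [RingHom.id_apply, smul_smul, smul_smul, Algebra.commutes] }

@[simp]
theorem centralEnd_apply (r : R) (M : ModuleCat.{u} A) (x : M) :
    (centralEnd r M).hom x = algebraMap R A r • x := rfl

theorem centralEnd_comp (r : R) {M N : ModuleCat.{u} A} (f : M ⟶ N) :
    centralEnd r M ≫ f = f ≫ centralEnd r N := by
  ext x
  simp

theorem centralEnd_mul (r s : R) (M : ModuleCat.{u} A) :
    centralEnd (r * s) M = centralEnd s M ≫ centralEnd r M := by
  ext x
  simp only [centralEnd_apply, map_mul, mul_smul, ModuleCat.hom_comp, LinearMap.comp_apply]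

theorem centralEnd_add (r s : R) (M : ModuleCat.{u} A) :
    centralEnd (r + s) M = centralEnd r M + centralEnd s M := by
  ext x
  simp [add_smul]

theorem centralEnd_one (M : ModuleCat.{u} A) : centralEnd (1 : R) M = 𝟙 M := by
  ext x
  simp

theorem centralEnd_zero (M : ModuleCat.{u} A) : centralEnd (0 : R) M = 0 := by
  ext x
  simp

/-- Central multiplication is natural, so it commutes with the extension class of a projective
presentation; dimension shifting reduces to degree 0. Thus R acts on Ext in only one way. -/
theorem mk₀_centralEnd_comp {M N : ModuleCat.{u} A} {i : ℕ} (r : R) (x : Ext M N i) :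
    (Ext.mk₀ (centralEnd r M)).comp x (zero_add i) =
      x.comp (Ext.mk₀ (centralEnd r N)) (add_zero i) := by
  induction i generalizing M with
  | zero =>
    obtain ⟨f, rfl⟩ := Ext.homEquiv₀.symm.surjective x
    simp [centralEnd_comp]
  | succ i ih =>
    have hS := ModuleCat.shortExact_projectiveShortComplex M
    have : Projective M.projectiveShortComplex.X₂ :=
      ModuleCat.projective_of_categoryTheory_projective _
    obtain ⟨y, rfl⟩ := Ext.contravariant_sequence_exact₃ hS N x (Ext.eq_zero_of_projective _)
      (add_comm 1 i)
    have := hS.extClass_naturality hS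
      { τ₁ := centralEnd r _, τ₂ := centralEnd r _, τ₃ := centralEnd r _,
        comm₁₂ := centralEnd_comp r _, comm₂₃ := centralEnd_comp r _ }
    rw [Ext.comp_assoc_of_third_deg_zero, ← ih, ← Ext.comp_assoc_of_second_deg_zero, this,
      Ext.comp_assoc _ _ _ (zero_add 1) (add_comm 1 i) (by lia)]

theorem res_map_exact (φ : A →ₐ[R] A') (T : ShortComplex (ModuleCat.{u} A')) (h : T.Exact) :
    (T.map (res φ)).Exact := by
  rw [ShortComplex.ShortExact.moduleCat_exact_iff_function_exact] at h ⊢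
  exact h

instance (φ : A →ₐ[R] A') : Limits.PreservesFiniteLimits (res φ) := by
  have := ((CategoryTheory.Functor.exact_tfae (res φ)).out 1 3).mp (res_map_exact φ)
  exact this.1

instance (φ : A →ₐ[R] A') : Limits.PreservesFiniteColimits (res φ) := by
  have := ((CategoryTheory.Functor.exact_tfae (res φ)).out 1 3).mp (res_map_exact φ)
  exact this.2

variable (S : Submonoid R)

theorem exists_common_denominator {ι : Type*} [Finite ι] (P : ι → R → Prop)
    (hP : ∀ i s t, P i s → P i (t * s)) (h : ∀ i, ∃ s ∈ S, P i s) : ∃ s ∈ S, ∀ i, P i s := by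
  cases nonempty_fintype ι
  choose s hs hPs using h
  classical
  refine ⟨∏ i, s i, prod_mem fun i _ ↦ hs i, fun i ↦ ?_⟩
  rw [← Finset.prod_erase_mul _ _ (Finset.mem_univ i)]
  exact hP _ _ _ (hPs i)

variable (φ : A →ₐ[R] A')

/-- A semilinear map `m` from an `A`-module to an `A'`-module is a localization at `S`. (For this,
`S` has to be inverted in `A'`.) -/
structure IsLocMap {M M' : Type*} [AddCommGroup M] [Module A M] [AddCommGroup M'] [Module A' M']
    (m : M →ₛₗ[φ.toRingHom] M') : Prop where
  surj : ∀ y : M', ∃ s ∈ S, ∃ x : M, algebraMap R A' s • y = m x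
  inj : ∀ x : M, m x = 0 → ∃ s ∈ S, algebraMap R A s • x = 0

variable {φ} in
/-- The morphism of `A`-modules given by a semilinear map. -/
def toRes {M : ModuleCat.{u} A} {M' : ModuleCat.{u} A'} (m : M →ₛₗ[φ.toRingHom] M') :
    M ⟶ (res φ).obj M' :=
  ModuleCat.ofHom (Y := (res φ).obj M')
    { toFun := m, map_add' := map_add m, map_smul' := m.map_smulₛₗ }

variable {φ} in
/-- The semilinear map given by a morphism of `A`-modules. -/
def ofRes {M : ModuleCat.{u} A} {M' : ModuleCat.{u} A'} (m : M ⟶ (res φ).obj M') :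
    M →ₛₗ[φ.toRingHom] M' where
  toFun := m.hom
  map_add' := map_add m.hom
  map_smul' := m.hom.map_smul

variable {φ} in
theorem map_algebraMap_smul {M M' : Type*} [AddCommGroup M] [Module A M] [AddCommGroup M']
    [Module A' M'] (m : M →ₛₗ[φ.toRingHom] M') (r : R) (x : M) :
    m (algebraMap R A r • x) = algebraMap R A' r • m x := by
  rw [m.map_smulₛₗ]
  exact congrArg (· • m x) (φ.commutes r)

section Loc

variable [hφ : IsLocalizedModule S φ.toLinearMap]

include hφ

theorem isUnit_algebraMap_of_mem {s : R} (hs : s ∈ S) : IsUnit (algebraMap R A' s) := by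
  have h := (Module.End.isUnit_iff _).mp (hφ.map_units ⟨s, hs⟩)
  obtain ⟨t, ht⟩ := h.2 1
  have ht' : algebraMap R A' s * t = 1 := by
    rw [← ht, Module.algebraMap_end_apply, Algebra.smul_def]
  exact ⟨⟨_, t, ht', by rw [← Algebra.commutes, ht']⟩, rfl⟩

theorem smul_left_cancel_of_mem {M' : Type*} [AddCommGroup M'] [Module A' M'] {s : R}
    (hs : s ∈ S) {x y : M'} (h : algebraMap R A' s • x = algebraMap R A' s • y) : x = y :=
  (isUnit_algebraMap_of_mem S φ hs).smul_left_cancel.mp h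

theorem exists_denominator (y : A') : ∃ s ∈ S, ∃ x : A, algebraMap R A' s * y = φ x := by
  obtain ⟨⟨x, s⟩, h⟩ := hφ.surj y
  exact ⟨s, s.2, x, by rw [← Algebra.smul_def]; exact h⟩

theorem exists_mul_eq_zero {x : A} (h : φ x = 0) : ∃ s ∈ S, algebraMap R A s * x = 0 := by
  obtain ⟨s, h⟩ := (IsLocalizedModule.eq_zero_iff S φ.toLinearMap).mp h
  exact ⟨s, s.2, by rw [← Algebra.smul_def]; exact h⟩

/-- The localization `A → A'`, as a semilinear map. -/
def selfMap (φ : A →ₐ[R] A') : A →ₛₗ[φ.toRingHom] A' where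
  toFun := φ
  map_add' := map_add φ
  map_smul' := map_mul φ

theorem isLocMap_selfMap : IsLocMap S φ (selfMap φ) :=
  ⟨exists_denominator S φ, fun _ ↦ exists_mul_eq_zero S φ⟩

variable {M M' N' : Type*} [AddCommGroup M] [Module A M] [AddCommGroup M'] [Module A' M']
  [AddCommGroup N'] [Module A' N'] {φ}

theorem IsLocMap.ext {m : M →ₛₗ[φ.toRingHom] M'} (hm : IsLocMap S φ m) {f g : M' →ₗ[A'] N'}
    (h : ∀ x, f (m x) = g (m x)) : f = g := by
  ext y
  obtain ⟨s, hs, x, hx⟩ := hm.surj y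
  refine smul_left_cancel_of_mem S φ hs ?_
  rw [← map_smul, ← map_smul, hx, h]

/-- This identifies the A'-span of the image of I with the localization of I. -/
theorem exists_denominator_of_mem_span (m : M →ₛₗ[φ.toRingHom] M') (I : Submodule A M) {y : M'}
    (hy : y ∈ Submodule.span A' (m '' I)) : ∃ s ∈ S, ∃ x ∈ I, algebraMap R A' s • y = m x := by
  induction hy using Submodule.span_induction with
  | mem y hy =>
    obtain ⟨x, hx, rfl⟩ := hy
    exact ⟨1, one_mem S, x, hx, by simp⟩
  | zero => exact ⟨1, one_mem S, 0, zero_mem I, (smul_zero _).trans (map_zero m).symm⟩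
  | add y z _ _ hy hz =>
    obtain ⟨s, hs, x, hx, h1⟩ := hy
    obtain ⟨t, ht, w, hw, h2⟩ := hz
    refine ⟨s * t, mul_mem hs ht, algebraMap R A t • x + algebraMap R A s • w,
      I.add_mem (I.smul_mem _ hx) (I.smul_mem _ hw), ?_⟩
    rw [map_add, map_algebraMap_smul, map_algebraMap_smul, ← h1, ← h2, smul_smul, smul_smul,
      ← map_mul, ← map_mul, mul_comm t, smul_add]
  | smul a y _ hy =>
    obtain ⟨s, hs, x, hx, h1⟩ := hy
    obtain ⟨t, ht, b, hb⟩ := exists_denominator S φ a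
    refine ⟨s * t, mul_mem hs ht, b • x, I.smul_mem b hx, ?_⟩
    rw [m.map_smulₛₗ, ← h1]
    change _ = φ b • _
    rw [← hb, smul_smul, smul_smul, map_mul, Algebra.commutes s (algebraMap R A' t), mul_assoc,
      mul_assoc, Algebra.commutes s a]

/-- Semilinear maps into `A'`-modules extend along localizations. -/
theorem IsLocMap.exists_lift {m : M →ₛₗ[φ.toRingHom] M'} (hm : IsLocMap S φ m)
    (g : M →ₛₗ[φ.toRingHom] N') : ∃ f : M' →ₗ[A'] N', ∀ x, f (m x) = g x := by
  -- The value z must serve every denominator of y at once; this makes the chosen function additive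
  -- and linear.
  have key (y : M') : ∃ z : N', ∀ s ∈ S, ∀ x : M, algebraMap R A' s • y = m x →
      algebraMap R A' s • z = g x := by
    obtain ⟨s, hs, x, hx⟩ := hm.surj y
    obtain ⟨u, hu⟩ := isUnit_algebraMap_of_mem S φ hs
    have hz : algebraMap R A' s • (↑u⁻¹ : A') • g x = g x := by
      rw [← hu, smul_smul, Units.mul_inv, one_smul]
    refine ⟨(↑u⁻¹ : A') • g x, fun t ht w hw ↦ ?_⟩
    have h0 : m (algebraMap R A s • w - algebraMap R A t • x) = 0 := by
      rw [map_sub, map_algebraMap_smul, map_algebraMap_smul, ← hw, ← hx, smul_smul, smul_smul,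
        Algebra.commutes, sub_self]
    obtain ⟨r, hr, h1⟩ := hm.inj _ h0
    refine smul_left_cancel_of_mem S φ hs (smul_left_cancel_of_mem S φ hr ?_)
    have h2 := congrArg g h1
    rw [map_algebraMap_smul, map_sub, map_algebraMap_smul, map_algebraMap_smul, map_zero,
      smul_sub, sub_eq_zero] at h2
    rw [h2, smul_smul (algebraMap R A' s), Algebra.commutes, ← smul_smul, hz]
  choose f hf using key
  have hmul {y : M'} {z : N'} {s : R} (hs : s ∈ S) {x : M} (hx : algebraMap R A' s • y = m x)
      (hz : algebraMap R A' s • z = g x) : f y = z :=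
    smul_left_cancel_of_mem S φ hs ((hf y s hs x hx).trans hz.symm)
  have hlin (a : A) (y : M') : f (φ a • y) = φ a • f y := by
    obtain ⟨s, hs, x, hx⟩ := hm.surj y
    refine hmul hs (x := a • x) ?_ ?_
    · rw [m.map_smulₛₗ, ← hx, smul_smul, Algebra.commutes, ← smul_smul]; rfl
    · rw [g.map_smulₛₗ, ← hf _ _ hs _ hx, smul_smul, Algebra.commutes, ← smul_smul]; rfl
  refine ⟨{ toFun := f, map_add' := fun y₁ y₂ ↦ ?_, map_smul' := fun a y ↦ ?_ }, ?_⟩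
  · obtain ⟨s, hs, x, hx⟩ := hm.surj y₁
    obtain ⟨t, ht, w, hw⟩ := hm.surj y₂
    refine hmul (mul_mem hs ht) (x := algebraMap R A t • x + algebraMap R A s • w) ?_ ?_
    · rw [map_add, map_algebraMap_smul, map_algebraMap_smul, ← hx, ← hw, smul_smul, smul_smul,
        ← map_mul, ← map_mul, mul_comm t, smul_add]
    · rw [map_add, map_algebraMap_smul, map_algebraMap_smul, ← hf _ _ hs _ hx, ← hf _ _ ht _ hw,
        smul_smul, smul_smul, ← map_mul, ← map_mul, mul_comm t, smul_add]
  · obtain ⟨s, hs, b, hb⟩ := exists_denominator S φ a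
    refine smul_left_cancel_of_mem S φ hs ?_
    have h1 := hlin (algebraMap R A s) (a • y)
    rw [φ.commutes] at h1
    rw [← h1, smul_smul, hb, hlin, RingHom.id_apply, smul_smul, hb]
  · exact fun x ↦ hmul (one_mem S) (x := x) (by rw [map_one, one_smul]) (by rw [map_one, one_smul])

variable (φ) in
-- An A'-module is its own localization, so an A-linear map between A'-modules extends along the
-- identity to an A'-linear one.
theorem res_full : (res φ).Full where
  map_surjective {M N} g := by
    have hid : IsLocMap S φ (ofRes (𝟙 ((res φ).obj M))) :=
      ⟨fun y ↦ ⟨1, one_mem S, y, by rw [map_one, one_smul]; rfl⟩,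
        fun x hx ↦ ⟨1, one_mem S, by rw [map_one, one_smul]; exact hx⟩⟩
    obtain ⟨f, hf⟩ := hid.exists_lift S (ofRes g)
    exact ⟨ModuleCat.ofHom f, by ext x; exact hf x⟩

theorem IsLocMap.bijective_comp {M : ModuleCat.{u} A} {M' : ModuleCat.{u} A'}
    {m : M →ₛₗ[φ.toRingHom] M'} (hm : IsLocMap S φ m) (N' : ModuleCat.{u} A') :
    Function.Bijective fun g : (res φ).obj M' ⟶ (res φ).obj N' ↦ toRes m ≫ g := by
  refine ⟨fun g h hgh ↦ ?_, fun g ↦ ?_⟩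
  · obtain ⟨g, rfl⟩ := (res_full S φ).map_surjective g
    obtain ⟨h, rfl⟩ := (res_full S φ).map_surjective h
    exact congrArg _ (ModuleCat.hom_ext (hm.ext S fun x ↦ congr($hgh x)))
  · obtain ⟨f, hf⟩ := hm.exists_lift S (ofRes g)
    exact ⟨(res φ).map (ModuleCat.ofHom f), by ext x; exact hf x⟩

variable (φ) in
-- By Baer's criterion: a map from a left ideal I of A extends to the ideal of A' generated by I,
-- then to A' by injectivity, and is restricted to A.
theorem res_preservesInjectiveObjects : (res φ).PreservesInjectiveObjects where
  injective_obj {N'} hN' := by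
    have hinj : Module.Injective A' N' := Module.injective_module_of_injective_object A' N'
    let : Module A N' := Module.compHom N' φ.toRingHom
    have : Module.Injective A N' := by
      refine Module.Baer.injective fun I g ↦ ?_
      let I' : Submodule A' A' := Submodule.span A' (selfMap φ '' I)
      let m : I →ₛₗ[φ.toRingHom] I' :=
        { toFun x := ⟨φ x, Submodule.subset_span ⟨x, x.2, rfl⟩⟩
          map_add' x y := Subtype.ext (map_add φ _ _)
          map_smul' a x := Subtype.ext (map_mul φ _ _) }
      have hm : IsLocMap S φ m := by
        refine ⟨fun y ↦ ?_, fun x hx ↦ ?_⟩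
        · obtain ⟨s, hs, x, hx, h⟩ := exists_denominator_of_mem_span S (selfMap φ) I y.2
          exact ⟨s, hs, ⟨x, hx⟩, Subtype.ext h⟩
        · obtain ⟨s, hs, h⟩ := exists_mul_eq_zero S φ (congrArg Subtype.val hx)
          exact ⟨s, hs, Subtype.ext h⟩
      obtain ⟨f, hf⟩ := hm.exists_lift S (N' := N')
        { toFun := g, map_add' := map_add g, map_smul' := g.map_smul }
      obtain ⟨f', hf'⟩ := hinj.out I'.subtype I'.injective_subtype f
      refine ⟨{ toFun x := f' (φ x), map_add' x y := ?_, map_smul' a x := ?_ }, fun x hx ↦ ?_⟩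
      · rw [map_add, map_add]
      · exact (congrArg f' (map_mul φ a x)).trans (f'.map_smul (φ a) (φ x))
      exact (hf' (m ⟨x, hx⟩)).trans (hf ⟨x, hx⟩)
    exact Module.injective_object_of_injective_module A N'

theorem ext_eq_zero_of_injective_res {M : ModuleCat.{u} A} {I : ModuleCat.{u} A'} [Injective I]
    {i : ℕ} (x : Ext M ((res φ).obj I) (i + 1)) : x = 0 := by
  have := res_preservesInjectiveObjects S φ
  have : Injective ((res φ).obj I) := Functor.PreservesInjectiveObjects.injective_obj ‹_›
  exact x.eq_zero_of_injective

/-- The map `Ext^i_{A'}(M', N') → Ext^i_A(M, N')` given by a localization `M → M'`. -/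
def extToRes {M : ModuleCat.{u} A} {M' : ModuleCat.{u} A'} (m : M →ₛₗ[φ.toRingHom] M')
    (N' : ModuleCat.{u} A') (i : ℕ) : Ext M' N' i →+ Ext M ((res φ).obj N') i :=
  ((Ext.mk₀ (toRes m)).precomp _ (zero_add i)).comp ((res φ).mapExtAddHom M' N' i)

omit hφ in
theorem extToRes_apply {M : ModuleCat.{u} A} {M' : ModuleCat.{u} A'} (m : M →ₛₗ[φ.toRingHom] M')
    (N' : ModuleCat.{u} A') (i : ℕ) (x : Ext M' N' i) :
    extToRes m N' i x = (Ext.mk₀ (toRes m)).comp (x.mapExactFunctor (res φ)) (zero_add i) := rfl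

/-- Restriction is exact, full and preserves injectives, so it identifies Ext over A' with Ext over
A. Precomposition with M → M' is bijective on Hom by the universal property, and in higher degrees
by dimension shifting along injectives over A', which stay injective over A. No finiteness is
needed. -/
theorem IsLocMap.bijective_ext {M : ModuleCat.{u} A} {M' : ModuleCat.{u} A'}
    {m : M →ₛₗ[φ.toRingHom] M'} (hm : IsLocMap S φ m) (N' : ModuleCat.{u} A') (i : ℕ) :
    Function.Bijective (extToRes m N' i) := by
  have := res_preservesInjectiveObjects S φ
  have := res_full S φ
  suffices h : Function.Bijective
      ((Ext.mk₀ (toRes m)).precomp ((res φ).obj N') (zero_add i)) from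
    h.comp ((res φ).mapExt_bijective_of_preservesInjectiveObjects M' N' i)
  induction i generalizing N' with
  | zero =>
    have h := hm.bijective_comp S N'
    refine ⟨fun x y hxy ↦ ?_, fun y ↦ ?_⟩
    · obtain ⟨x, rfl⟩ := Ext.homEquiv₀.symm.surjective x
      obtain ⟨y, rfl⟩ := Ext.homEquiv₀.symm.surjective y
      exact congrArg _ (h.1 (Ext.homEquiv₀.symm.injective (by simpa using hxy)))
    · obtain ⟨y, rfl⟩ := Ext.homEquiv₀.symm.surjective y
      obtain ⟨x, rfl⟩ := h.2 y
      exact ⟨Ext.mk₀ x, by simp⟩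
  | succ i ih =>
    let I : InjectivePresentation N' := Classical.arbitrary _
    let T := ShortComplex.mk _ _ (Limits.cokernel.condition I.f)
    have hT : T.ShortExact := { exact := ShortComplex.exact_cokernel I.f }
    have hT' := hT.map_of_exact (res φ)
    have : Injective T.X₂ := I.injective
    have hz {M : ModuleCat.{u} A} {i : ℕ} (x : Ext M (T.map (res φ)).X₂ (i + 1)) : x = 0 :=
      ext_eq_zero_of_injective_res S (I := T.X₂) x
    refine ⟨?_, fun y ↦ ?_⟩
    · rw [injective_iff_map_eq_zero]
      intro x hx
      obtain ⟨x', rfl⟩ := Ext.covariant_sequence_exact₁ _ hT' x (hz _) rfl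
      replace hx : (Ext.mk₀ (toRes m)).comp (x'.comp hT'.extClass rfl) (zero_add _) = 0 := hx
      rw [← Ext.comp_assoc _ _ _ (zero_add i) rfl (by lia)] at hx
      obtain ⟨w, hw⟩ := Ext.covariant_sequence_exact₃ _ hT' _ rfl hx
      obtain ⟨w', rfl⟩ := (ih T.X₂).2 w
      replace hw : (Ext.mk₀ (toRes m)).comp (w'.comp (Ext.mk₀ ((res φ).map T.g)) (add_zero i))
          (zero_add i) = (Ext.mk₀ (toRes m)).comp x' (zero_add i) :=
        (Ext.comp_assoc_of_third_deg_zero _ _ _ _).symm.trans hw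
      obtain rfl := (ih T.X₃).1 hw
      exact (Ext.comp_assoc _ _ _ (add_zero i) (zero_add 1) (by lia)).trans
        ((congrArg (w'.comp · _) hT'.comp_extClass).trans (Ext.comp_zero ..))
    · obtain ⟨y', rfl⟩ := Ext.covariant_sequence_exact₁ _ hT' y (hz _) rfl
      obtain ⟨x', rfl⟩ := (ih T.X₃).2 y'
      exact ⟨x'.comp hT'.extClass rfl, (Ext.comp_assoc _ _ _ (zero_add i) rfl (by lia)).symm⟩

end Loc

end CentralLocalization

/-! ### Clearing denominators in Hom and Ext -/

section LocalizationExt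

variable {R A A' : Type u} [CommRing R] [Ring A] [Algebra R A] [Ring A'] [Algebra R A']
  (S : Submonoid R) {φ : A →ₐ[R] A'}

theorem IsLocMap.exists_smul_comp_eq_zero {K N N' : Type*} [AddCommGroup K] [Module A K]
    [AddCommGroup N] [Module A N] [AddCommGroup N'] [Module A' N'] [Module.Finite A K]
    {ι : N →ₛₗ[φ.toRingHom] N'} (hι : IsLocMap S φ ι) (h : K →ₗ[A] N) (h0 : ∀ k, ι (h k) = 0) :
    ∃ s ∈ S, ∀ k, algebraMap R A s • h k = 0 := by
  obtain ⟨n, f, hf⟩ := Module.Finite.exists_fin' A K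
  obtain ⟨s, hs, h1⟩ := exists_common_denominator S
    (fun (i : Fin n) s ↦ algebraMap R A s • h (f (Pi.single i 1)) = 0)
    (fun i s t hs ↦ by rw [map_mul, mul_smul, hs, smul_zero]) fun i ↦ hι.inj _ (h0 _)
  refine ⟨s, hs, fun k ↦ ?_⟩
  obtain ⟨v, rfl⟩ := hf k
  rw [pi_eq_sum_univ' v, map_sum, map_sum, Finset.smul_sum]
  refine Finset.sum_eq_zero fun i _ ↦ ?_
  rw [map_smul, map_smul, smul_smul, Algebra.commutes, ← smul_smul, h1, smul_zero]

/-- One denominator lifts the images of finitely many generators. The relations between them are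
finitely generated, A being Noetherian, so a second denominator makes the lift respect them. -/
theorem IsLocMap.exists_smul_lift [IsNoetherianRing A] {K N N' : Type u} [AddCommGroup K]
    [Module A K] [AddCommGroup N] [Module A N] [AddCommGroup N'] [Module A' N'] [Module.Finite A K]
    {ι : N →ₛₗ[φ.toRingHom] N'} (hι : IsLocMap S φ ι) (g : K →ₛₗ[φ.toRingHom] N') :
    ∃ s ∈ S, ∃ h : K →ₗ[A] N, ∀ k, ι (h k) = algebraMap R A' s • g k := by
  obtain ⟨n, f, hf⟩ := Module.Finite.exists_fin' A K
  obtain ⟨s, hs, h1⟩ := exists_common_denominator S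
    (fun (i : Fin n) s ↦ ∃ x, algebraMap R A' s • g (f (Pi.single i 1)) = ι x)
    (fun i s t ⟨x, hx⟩ ↦ ⟨algebraMap R A t • x, by
      rw [map_mul, mul_smul, hx, map_algebraMap_smul]⟩) fun i ↦ hι.surj _
  choose x hx using h1
  let h₀ : (Fin n → A) →ₗ[A] N := Fintype.linearCombination A x
  have hh₀ (v : Fin n → A) : ι (h₀ v) = algebraMap R A' s • g (f v) := by
    conv_rhs => rw [pi_eq_sum_univ' v]
    rw [Fintype.linearCombination_apply, map_sum, map_sum, map_sum, Finset.smul_sum]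
    refine Finset.sum_congr rfl fun i _ ↦ ?_
    rw [f.map_smul, g.map_smulₛₗ, ι.map_smulₛₗ, ← hx, smul_smul, smul_smul, Algebra.commutes]
  obtain ⟨t, ht, h2⟩ := hι.exists_smul_comp_eq_zero S (h₀ ∘ₗ (LinearMap.ker f).subtype)
    fun k ↦ by
      rw [LinearMap.comp_apply, hh₀, Submodule.subtype_apply, LinearMap.mem_ker.mp k.2, map_zero,
        smul_zero]
  let e := f.quotKerEquivOfSurjective hf
  let h₁ : ((Fin n → A) ⧸ LinearMap.ker f) →ₗ[A] N := (LinearMap.ker f).liftQ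
    ((centralEnd t (ModuleCat.of A N)).hom ∘ₗ h₀) fun k hk ↦ h2 ⟨k, hk⟩
  refine ⟨t * s, mul_mem ht hs, h₁ ∘ₗ e.symm.toLinearMap, fun k ↦ ?_⟩
  obtain ⟨v, rfl⟩ := hf k
  have : e.symm (f v) = (LinearMap.ker f).mkQ v := by
    rw [LinearEquiv.symm_apply_eq]; rfl
  rw [LinearMap.comp_apply, LinearEquiv.coe_coe, this]
  change ι (algebraMap R A t • h₀ v) = _
  rw [map_algebraMap_smul, hh₀, smul_smul, map_mul]

/-- Written through the universal class, y becomes a map out of a finite module, where denominators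
can be cleared. Together with `IsLocMap.ext_inj` this says that Ext^i(M, -) commutes with
localization. -/
theorem IsLocMap.ext_surj [IsNoetherianRing A] {M N : ModuleCat.{u} A} [Module.Finite A M]
    {N' : ModuleCat.{u} A'} {ι : N →ₛₗ[φ.toRingHom] N'} (hι : IsLocMap S φ ι) {i : ℕ}
    (y : Ext M ((res φ).obj N') i) : ∃ s ∈ S, ∃ x : Ext M N i,
      x.comp (Ext.mk₀ (toRes ι)) (add_zero i) =
        y.comp (Ext.mk₀ (centralEnd s _)) (add_zero i) := by
  obtain ⟨K, F, j, η, hK, hF, h⟩ := exists_universal_ext i M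
  obtain ⟨g, rfl⟩ := (h _).1 y
  obtain ⟨s, hs, k, hk⟩ := hι.exists_smul_lift S (ofRes g)
  refine ⟨s, hs, η.comp (Ext.mk₀ (ModuleCat.ofHom k)) (add_zero i), ?_⟩
  rw [Ext.comp_assoc_of_third_deg_zero, Ext.comp_assoc_of_third_deg_zero, Ext.mk₀_comp_mk₀,
    Ext.mk₀_comp_mk₀]
  congr 2
  ext x
  refine (hk x).trans ?_
  rw [← φ.commutes]
  rfl

theorem IsLocMap.ext_inj [IsNoetherianRing A] {M N : ModuleCat.{u} A} [Module.Finite A M]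
    {N' : ModuleCat.{u} A'} {ι : N →ₛₗ[φ.toRingHom] N'} (hι : IsLocMap S φ ι) {i : ℕ}
    (x : Ext M N i) (hx : x.comp (Ext.mk₀ (toRes ι)) (add_zero i) = 0) : ∃ s ∈ S,
      x.comp (Ext.mk₀ (centralEnd s N)) (add_zero i) = 0 := by
  obtain ⟨K, F, j, η, hK, hF, h⟩ := exists_universal_ext i M
  obtain ⟨k, rfl⟩ := (h _).1 x
  rw [Ext.comp_assoc_of_third_deg_zero, Ext.mk₀_comp_mk₀, (h _).2] at hx
  obtain ⟨g', hg'⟩ := hx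
  obtain ⟨s, hs, f, hf⟩ := hι.exists_smul_lift S (ofRes g')
  obtain ⟨t, ht, h1⟩ := hι.exists_smul_comp_eq_zero S
      ((k ≫ centralEnd s N).hom - f ∘ₗ j.hom) fun x ↦ by
    have h2 : ι (k.hom x) = (ofRes g') (j.hom x) := congr($hg' x).symm
    rw [LinearMap.sub_apply, map_sub, LinearMap.comp_apply, hf, ModuleCat.hom_comp,
      LinearMap.comp_apply, centralEnd_apply, map_algebraMap_smul, h2, sub_self]
  refine ⟨t * s, mul_mem ht hs, ?_⟩
  rw [Ext.comp_assoc_of_third_deg_zero, Ext.mk₀_comp_mk₀, (h _).2]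
  refine ⟨ModuleCat.ofHom f ≫ centralEnd t N, ?_⟩
  ext x
  have := h1 x
  rw [LinearMap.sub_apply, smul_sub, sub_eq_zero] at this
  rw [centralEnd_mul]
  exact this.symm

variable [hφ : IsLocalizedModule S φ.toLinearMap]

include hφ

variable (φ) in
-- The action of A on N localizes to a linear map A → End(S⁻¹N). Elements of S act invertibly on the
-- target, so the map extends to A', and it remains multiplicative there.
theorem exists_isLocMap (N : ModuleCat.{u} A) :
    ∃ (N' : ModuleCat.{u} A') (ι : N →ₛₗ[φ.toRingHom] N'), IsLocMap S φ ι := by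
  let : Module R N := Module.compHom N (algebraMap R A)
  have : IsScalarTower R A N := ⟨fun r a x ↦ by
    rw [Algebra.smul_def, mul_smul]; rfl⟩
  let f := LocalizedModule.mkLinearMap S N
  let ψ : A →ₗ[R] Module.End R (LocalizedModule S N) :=
    IsLocalizedModule.map S f f ∘ₗ (Algebra.lsmul R R N).toLinearMap
  have hψ (a : A) (x : N) : ψ a (f x) = f (a • x) := IsLocalizedModule.map_apply S f f _ _
  have hψmul (a b : A) : ψ (a * b) = ψ a * ψ b := by
    refine IsLocalizedModule.ext S f (IsLocalizedModule.map_units f) ?_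
    ext x
    simp only [LinearMap.comp_apply, Module.End.mul_apply, hψ, mul_smul]
  have hunit (s : S) :
      IsUnit (algebraMap R (Module.End R (Module.End R (LocalizedModule S N))) s) := by
    have h := IsLocalizedModule.map_units f s
    obtain ⟨e, he⟩ := h
    have hs (g : Module.End R (LocalizedModule S N)) : (s : R) • g = e * g := by
      rw [he, Algebra.smul_def]
    rw [Module.End.isUnit_iff]
    refine ⟨fun g h hgh ↦ ?_, fun g ↦ ⟨↑e⁻¹ * g, ?_⟩⟩
    · simp only [Module.algebraMap_end_apply, hs] at hgh
      exact (Units.mul_right_inj e).mp hgh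
    · rw [Module.algebraMap_end_apply, hs, Units.mul_inv_cancel_left]
  let Ψ : A' →ₗ[R] Module.End R (LocalizedModule S N) :=
    IsLocalizedModule.lift S φ.toLinearMap ψ hunit
  have hΨ (a : A) : Ψ (φ a) = ψ a := IsLocalizedModule.lift_apply S φ.toLinearMap ψ hunit a
  have hone : Ψ 1 = 1 := by
    rw [← map_one φ, hΨ]
    refine IsLocalizedModule.ext S f (IsLocalizedModule.map_units f) ?_
    ext x
    simp only [LinearMap.comp_apply, Module.End.one_apply, hψ, one_smul]
  have hmul (y z : A') : Ψ (y * z) = Ψ y * Ψ z := by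
    obtain ⟨⟨a, s⟩, ha⟩ := hφ.surj y
    obtain ⟨⟨b, t⟩, hb⟩ := hφ.surj z
    replace ha : (s : R) • y = φ a := ha
    replace hb : (t : R) • z = φ b := hb
    have hinj (s : S) := ((Module.End.isUnit_iff _).mp (hunit s)).1
    refine hinj s (hinj t ?_)
    simp only [Module.algebraMap_end_apply]
    rw [← map_smul, ← map_smul, ← smul_mul_assoc, ← mul_smul_comm, ha, hb, ← map_mul, hΨ, hψmul,
      ← hΨ, ← hΨ, ← ha, ← hb, map_smul, map_smul, mul_smul_comm, smul_mul_assoc]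
  let Φ : A' →+* Module.End R (LocalizedModule S N) :=
    { toFun := Ψ, map_one' := hone, map_mul' := hmul, map_zero' := map_zero Ψ
      map_add' := map_add Ψ }
  let : Module A' (LocalizedModule S N) := Module.compHom _ Φ
  have hr (r : R) (y : LocalizedModule S N) : algebraMap R A' r • y = r • y := by
    change Ψ (algebraMap R A' r) y = r • y
    rw [Algebra.algebraMap_eq_smul_one, map_smul, hone, LinearMap.smul_apply, Module.End.one_apply]
  refine ⟨ModuleCat.of A' (LocalizedModule S N),
    { toFun := f, map_add' := map_add f, map_smul' := fun a x ↦ ?_ }, fun y ↦ ?_, fun x hx ↦ ?_⟩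
  · rw [← hψ, ← hΨ]; rfl
  · obtain ⟨⟨x, s⟩, h⟩ := IsLocalizedModule.surj S f y
    exact ⟨s, s.2, x, (hr s y).trans h⟩
  · obtain ⟨s, h⟩ := (IsLocalizedModule.eq_zero_iff S f).mp hx
    exact ⟨s, s.2, h⟩

theorem IsLocMap.finite {M M' : Type*} [AddCommGroup M] [Module A M] [AddCommGroup M']
    [Module A' M'] {m : M →ₛₗ[φ.toRingHom] M'} (hm : IsLocMap S φ m) [hM : Module.Finite A M] :
    Module.Finite A' M' := by
  obtain ⟨T, hT⟩ := hM.fg_top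
  classical
  refine ⟨⟨T.image m, eq_top_iff.mpr fun y _ ↦ ?_⟩⟩
  obtain ⟨s, hs, x, hx⟩ := hm.surj y
  obtain ⟨u, hu⟩ := isUnit_algebraMap_of_mem S φ hs
  have : y = (↑u⁻¹ : A') • m x := by rw [← hx, ← hu, smul_smul, Units.inv_mul, one_smul]
  rw [this]
  refine Submodule.smul_mem _ _ ?_
  clear hx this
  have hx' : x ∈ Submodule.span A (T : Set M) := hT ▸ Submodule.mem_top
  induction hx' using Submodule.span_induction with
  | mem x hx => exact Submodule.subset_span (Finset.mem_coe.mpr (Finset.mem_image_of_mem m hx))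
  | zero => rw [map_zero]; exact zero_mem _
  | add x y _ _ hx hy => rw [map_add]; exact add_mem hx hy
  | smul a x _ hx => rw [m.map_smulₛₗ]; exact Submodule.smul_mem _ _ hx

variable (φ) in
-- The A-span of finitely many A'-generators of M' serves as M.
theorem exists_finite_isLocMap (M' : ModuleCat.{u} A') [hM' : Module.Finite A' M'] :
    ∃ (M : ModuleCat.{u} A) (_ : Module.Finite A M) (m : M →ₛₗ[φ.toRingHom] M'),
      IsLocMap S φ m := by
  obtain ⟨T, hT⟩ := hM'.fg_top
  let M := Submodule.span A (M := (res φ).obj M') (T : Set M')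
  refine ⟨ModuleCat.of A M, Module.Finite.span_of_finite A T.finite_toSet,
    ofRes (M := ModuleCat.of A M) (ModuleCat.ofHom (Y := (res φ).obj M') M.subtype), ?_⟩
  refine ⟨fun y ↦ ?_, fun x hx ↦ ?_⟩
  · have hy : y ∈ Submodule.span A' (T : Set M') := hT ▸ Submodule.mem_top
    have hsub : (T : Set M') ⊆ ofRes (𝟙 ((res φ).obj M')) '' (M : Set ((res φ).obj M')) :=
      fun y hy ↦ ⟨y, Submodule.subset_span hy, rfl⟩
    obtain ⟨s, hs, x, hx, h⟩ := exists_denominator_of_mem_span S (ofRes (𝟙 ((res φ).obj M'))) M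
      (Submodule.span_mono hsub hy)
    exact ⟨s, hs, ⟨x, hx⟩, h⟩
  · exact ⟨1, one_mem S, by rw [map_one, one_smul]; exact Subtype.ext hx⟩

end LocalizationExt

/-! ### Localization of Ext into the ring and of the Auslander condition -/

section ExtToRing

variable {R A A' : Type u} [CommRing R] [Ring A] [Algebra R A] [Ring A'] [Algebra R A']

theorem le_grade_iff {M : ModuleCat.{u} A} {i : ℕ} :
    (i : ℕ∞) ≤ grade A M ↔ ∀ j < i, Subsingleton (ExtToRing A M j) := by
  simp only [grade, le_iInf_iff, Nat.cast_le, ← not_nontrivial_iff_subsingleton]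
  exact forall_congr' fun j ↦ ⟨fun h hj hn ↦ by have := h hn; lia,
    fun h hn ↦ not_lt.mp fun hj ↦ h hj hn⟩

theorem op_smul_extToRing {M : ModuleCat.{u} A} {i : ℕ} (a : Aᵐᵒᵖ) (x : ExtToRing A M i) :
    a • x = (show Ext M (ModuleCat.of A A) i from x).comp (Ext.mk₀ (rightMul a.unop))
      (add_zero i) := rfl

theorem rightMul_algebraMap (r : R) :
    rightMul (algebraMap R A r) = centralEnd r (ModuleCat.of A A) := by
  ext
  simp [rightMul, -centralEnd_apply]
  exact (mul_one _).symm

theorem map_rightMul_algebraMap (φ : A →ₐ[R] A') (r : R) :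
    (res φ).map (rightMul (algebraMap R A' r)) =
      centralEnd r ((res φ).obj (ModuleCat.of A' A')) := by
  ext x
  change (show A' from x) * algebraMap R A' r = φ (algebraMap R A r) * (show A' from x)
  rw [φ.commutes, Algebra.commutes]

theorem toRes_selfMap_comp_map_rightMul (φ : A →ₐ[R] A') (a : A) :
    toRes (M := ModuleCat.of A A) (M' := ModuleCat.of A' A') (selfMap φ) ≫
        (res φ).map (rightMul (φ a)) =
      rightMul a ≫ toRes (M := ModuleCat.of A A) (M' := ModuleCat.of A' A') (selfMap φ) := by
  ext
  change φ 1 * φ a = φ (1 * a)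
  rw [map_mul]

/-- By the universal class, Ext^i(M, A) is a quotient of Hom(K, A), which embeds in a finite power
of A as a right module. Hence its right submodules are finite, and their Ext groups localize too. -/
instance isNoetherian_extToRing [IsNoetherianRing A] [IsNoetherianRing Aᵐᵒᵖ]
    (M : ModuleCat.{u} A) [Module.Finite A M] (i : ℕ) : IsNoetherian Aᵐᵒᵖ (ExtToRing A M i) := by
  obtain ⟨K, F, j, η, hK, hF, h⟩ := exists_universal_ext i M
  let e : Aᵐᵒᵖ ≃ₗ[Aᵐᵒᵖ] A :=
    { MulOpposite.opAddEquiv.symm with map_smul' := fun a b ↦ rfl }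
  have : IsNoetherian Aᵐᵒᵖ A := isNoetherian_of_linearEquiv e
  obtain ⟨n, f, hf⟩ := Module.Finite.exists_fin' A K
  let l : (K →ₗ[A] A) →ₗ[Aᵐᵒᵖ] (Fin n → A) :=
    { toFun g i := g (f (Pi.single i 1))
      map_add' _ _ := rfl
      map_smul' _ _ := rfl }
  have hl : Function.Injective l := fun g g' hg ↦ by
    have : g ∘ₗ f = g' ∘ₗ f := by
      ext i
      exact congrFun hg i
    exact LinearMap.ext fun x ↦ by
      obtain ⟨v, rfl⟩ := hf x
      exact congr($this v)
  have : IsNoetherian Aᵐᵒᵖ (K →ₗ[A] A) := isNoetherian_of_injective l hl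
  let p : (K →ₗ[A] A) →ₗ[Aᵐᵒᵖ] ExtToRing A M i :=
    { toFun g := η.comp (Ext.mk₀ (ModuleCat.ofHom (Y := ModuleCat.of A A) g)) (add_zero i)
      map_add' g g' := by
        rw [ModuleCat.ofHom_add, Ext.mk₀_add, Ext.comp_add]; rfl
      map_smul' a g := by
        refine Eq.trans ?_ (Ext.comp_assoc_of_third_deg_zero η
          (Ext.mk₀ (ModuleCat.ofHom (Y := ModuleCat.of A A) g)) (Ext.mk₀ (rightMul a.unop))
          (add_zero i)).symm
        rw [Ext.mk₀_comp_mk₀]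
        rfl }
  refine isNoetherian_of_surjective (f := p) (LinearMap.range_eq_top.mpr fun x ↦ ?_)
  obtain ⟨g, hg⟩ := (h _).1 x
  exact ⟨g.hom, hg⟩

variable (S : Submonoid R) {φ : A →ₐ[R] A'}

theorem isLocalizedModule_op [IsLocalizedModule S φ.toLinearMap] :
    IsLocalizedModule S (AlgHom.op φ).toLinearMap :=
  inferInstanceAs (IsLocalizedModule S ((MulOpposite.opLinearEquiv R : A' ≃ₗ[R] A'ᵐᵒᵖ).toLinearMap
    ∘ₗ (φ.toLinearMap ∘ₗ (MulOpposite.opLinearEquiv R : A ≃ₗ[R] Aᵐᵒᵖ).symm.toLinearMap)))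

variable [hφ : IsLocalizedModule S φ.toLinearMap]

section

variable {M M' : Type*} [AddCommGroup M] [Module A M] [AddCommGroup M'] [Module A' M']
  {m : M →ₛₗ[φ.toRingHom] M'}

include hφ

theorem IsLocMap.subsingleton [Subsingleton M] (hm : IsLocMap S φ m) : Subsingleton M' := by
  refine subsingleton_of_forall_eq 0 fun y ↦ ?_
  obtain ⟨s, hs, x, hx⟩ := hm.surj y
  refine smul_left_cancel_of_mem S φ hs ?_
  rw [hx, Subsingleton.elim x 0, map_zero, smul_zero]

omit hφ in
theorem IsLocMap.comap (hm : IsLocMap S φ m) (N' : Submodule A' M') :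
    ∃ n : N'.comap m →ₛₗ[φ.toRingHom] N', IsLocMap S φ n := by
  refine ⟨m.restrict fun x hx ↦ hx, fun y ↦ ?_, fun x hx ↦ ?_⟩
  · obtain ⟨s, hs, x, hx⟩ := hm.surj y
    exact ⟨s, hs, ⟨x, Submodule.mem_comap.mpr (hx ▸ N'.smul_mem _ y.2)⟩, Subtype.ext hx⟩
  · obtain ⟨s, hs, h⟩ := hm.inj x (congrArg Subtype.val hx)
    exact ⟨s, hs, Subtype.ext h⟩

theorem IsLocMap.span (hm : IsLocMap S φ m) (N : Submodule A M) :
    ∃ n : N →ₛₗ[φ.toRingHom] Submodule.span A' (m '' N), IsLocMap S φ n := by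
  refine ⟨m.restrict fun x hx ↦ Submodule.subset_span ⟨x, hx, rfl⟩, fun y ↦ ?_, fun x hx ↦ ?_⟩
  · obtain ⟨s, hs, x, hx, h⟩ := exists_denominator_of_mem_span S m N y.2
    exact ⟨s, hs, ⟨x, hx⟩, Subtype.ext h⟩
  · obtain ⟨s, hs, h⟩ := hm.inj x (congrArg Subtype.val hx)
    exact ⟨s, hs, Subtype.ext h⟩

theorem IsLocMap.isNoetherian [IsNoetherian A M] (hm : IsLocMap S φ m) : IsNoetherian A' M' := by
  refine ⟨fun N' ↦ ?_⟩
  obtain ⟨n, hn⟩ := hm.comap S N'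
  exact (Submodule.fg_top N').mp (hn.finite S).fg_top

variable (φ) in
theorem isNoetherianRing_of_isLocalizedModule [IsNoetherianRing A] : IsNoetherianRing A' :=
  (isLocMap_selfMap S φ).isNoetherian S

end

/-- A localization `M → M'` induces a localization `Ext^i_A(M, A) → Ext^i_{A'}(M', A')`. -/
theorem IsLocMap.exists_extToRing [IsNoetherianRing A] {M : ModuleCat.{u} A} [Module.Finite A M]
    {M' : ModuleCat.{u} A'} {m : M →ₛₗ[φ.toRingHom] M'} (hm : IsLocMap S φ m) (i : ℕ) :
    ∃ Φ : ExtToRing A M i →ₛₗ[(AlgHom.op φ).toRingHom] ExtToRing A' M' i,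
      IsLocMap S (AlgHom.op φ) Φ := by
  -- E identifies Ext over A' of M' with Ext^i_A(M, A'). The wanted map pushes a class forward along
  -- A → A' and applies the inverse of E; right linearity needs E to respect right multiplication.
  let E := AddEquiv.ofBijective _ (hm.bijective_ext S (ModuleCat.of A' A') i)
  have hE (x : Ext M' (ModuleCat.of A' A') i) (b : A') : E (x.comp (Ext.mk₀ (rightMul b))
      (add_zero i)) = (E x).comp (Ext.mk₀ ((res φ).map (rightMul b))) (add_zero i) := by
    change extToRes m _ i _ = (extToRes m _ i x).comp _ _
    rw [extToRes_apply, extToRes_apply, Ext.mapExactFunctor_comp, Ext.mapExactFunctor_mk₀,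
      Ext.comp_assoc_of_third_deg_zero]
  let ι := toRes (M := ModuleCat.of A A) (M' := ModuleCat.of A' A') (selfMap φ)
  let Φ : ExtToRing A M i →ₛₗ[(AlgHom.op φ).toRingHom] ExtToRing A' M' i :=
    { toFun x := E.symm ((show Ext M (ModuleCat.of A A) i from x).comp (Ext.mk₀ ι) (add_zero i))
      map_add' x y := by
        refine E.injective ?_
        refine Eq.trans ?_ (map_add E _ _).symm
        rw [E.apply_symm_apply, E.apply_symm_apply, E.apply_symm_apply]
        exact Ext.add_comp ..
      map_smul' a x := by
        refine E.injective ((E.apply_symm_apply _).trans (Eq.trans ?_ (hE _ _).symm))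
        rw [E.apply_symm_apply]
        refine (Ext.comp_assoc_of_third_deg_zero (show Ext M (ModuleCat.of A A) i from x)
          (Ext.mk₀ (rightMul a.unop)) (Ext.mk₀ ι) (add_zero i)).trans ?_
        rw [Ext.comp_assoc_of_third_deg_zero, Ext.mk₀_comp_mk₀, Ext.mk₀_comp_mk₀]
        exact congrArg (fun f ↦ Ext.comp _ (Ext.mk₀ f) _)
          (toRes_selfMap_comp_map_rightMul φ a.unop).symm }
  refine ⟨Φ, fun y ↦ ?_, fun x hx ↦ ?_⟩
  · obtain ⟨s, hs, x, hx⟩ := (isLocMap_selfMap S φ).ext_surj (N := ModuleCat.of A A)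
      (N' := ModuleCat.of A' A') S (E y)
    refine ⟨s, hs, x, E.injective ?_⟩
    rw [op_smul_extToRing]
    refine (hE y _).trans ?_
    refine Eq.trans ?_ (hx.symm.trans (E.apply_symm_apply _).symm)
    rw [← map_rightMul_algebraMap]
    rfl
  · have hx' : (show Ext M (ModuleCat.of A A) i from x).comp (Ext.mk₀ ι) (add_zero i) = 0 :=
      E.symm.injective (hx.trans (map_zero _).symm)
    obtain ⟨s, hs, h⟩ := (isLocMap_selfMap S φ).ext_inj (N := ModuleCat.of A A)
      (N' := ModuleCat.of A' A') S x hx'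
    refine ⟨s, hs, ?_⟩
    rw [← rightMul_algebraMap] at h
    exact h

include hφ

variable (φ) in
-- M' comes from a finite M, and N' is the localization of its preimage in Ext^i_A(M, A). The
-- vanishing of Ext^j of that preimage then localizes.
theorem AuslanderCondition.of_isLocalizedModule [IsNoetherianRing A] [IsNoetherianRing Aᵐᵒᵖ]
    (h : AuslanderCondition A) : AuslanderCondition A' := by
  intro M' _ i N'
  rw [le_grade_iff]
  intro j hj
  have := isLocalizedModule_op S (φ := φ)
  obtain ⟨M, _, m, hm⟩ := exists_finite_isLocMap S φ M'
  obtain ⟨Φ, hΦ⟩ := hm.exists_extToRing S i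
  obtain ⟨n, hn⟩ := hΦ.comap S N'
  obtain ⟨Ψ, hΨ⟩ := hn.exists_extToRing (M := ModuleCat.of Aᵐᵒᵖ (N'.comap Φ))
    (M' := ModuleCat.of A'ᵐᵒᵖ N') S j
  have := isLocalizedModule_op S (φ := AlgHom.op φ)
  have := le_grade_iff.mp (h M inferInstance i (N'.comap Φ)) j hj
  exact hΨ.subsingleton S

theorem IsLocMap.ext_eq_zero {M : ModuleCat.{u} A} {M' : ModuleCat.{u} A'}
    {m : M →ₛₗ[φ.toRingHom] M'} (hm : IsLocMap S φ m) {i : ℕ}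
    (h : ∀ (N : ModuleCat.{u} A) (x : Ext M N i), x = 0) (N' : ModuleCat.{u} A')
    (x : Ext M' N' i) : x = 0 :=
  (hm.bijective_ext S N' i).1 ((h _ _).trans (map_zero _).symm)

end ExtToRing

/-! ### Global dimension over Noetherian rings -/

section GlobalDimension

variable {A : Type u} [Ring A]

theorem IsAuslanderRegular.mk' (h₁ : IsNoetherianRing A) (h₂ : AuslanderCondition A)
    (h₃ : ∃ n : ℕ, ∀ M : ModuleCat.{u} A, HasProjectiveDimensionLE M n) : IsAuslanderRegular A := by
  obtain ⟨n, hn⟩ := h₃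
  exact ⟨⟨h₁, h₂, n, HasInjectiveDimensionLT.mk fun i hi Y x ↦
    x.eq_zero_of_hasProjectiveDimensionLT (n + 1) hi⟩, n, hn⟩

/-- The universal class has values in a finite module; once it vanishes, so do all classes. -/
theorem hasProjectiveDimensionLE_of_forall_finite_finite [IsNoetherianRing A] (n : ℕ)
    (h : ∀ (M : ModuleCat.{u} A) [Module.Finite A M] (Y : ModuleCat.{u} A) [Module.Finite A Y]
      (x : Ext M Y (n + 1)), x = 0) (M : ModuleCat.{u} A) : HasProjectiveDimensionLE M n := by
  refine hasProjectiveDimensionLE_of_forall_finite n (fun M _ Y x ↦ ?_) M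
  obtain ⟨K, F, j, η, _, _, hη⟩ := exists_universal_ext (n + 1) M
  obtain ⟨g, rfl⟩ := (hη Y).1 x
  rw [h M K η, Ext.zero_comp]

end GlobalDimension

/-! ### Passing to localizations and descending from covers -/

section LocalGlobal

variable {R A : Type u} [CommRing R] [Ring A] [Algebra R A]

theorem IsAuslanderRegular.of_isLocalizedModule {A' : Type u} [Ring A'] [Algebra R A']
    [IsNoetherianRing Aᵐᵒᵖ] (S : Submonoid R) (φ : A →ₐ[R] A') [IsLocalizedModule S φ.toLinearMap]
    (h : IsAuslanderRegular A) : IsAuslanderRegular A' := by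
  have := h.isNoetherianRing
  refine .mk' (isNoetherianRing_of_isLocalizedModule S φ)
    (h.auslanderCondition.of_isLocalizedModule S φ) ?_
  obtain ⟨n, hn⟩ := h.finite_globalDimension
  refine ⟨n, fun M' ↦ HasProjectiveDimensionLT.mk fun i hi Y x ↦ ?_⟩
  have hid : IsLocMap S φ (ofRes (𝟙 ((res φ).obj M'))) :=
    ⟨fun y ↦ ⟨1, one_mem S, y, by rw [map_one, one_smul]; rfl⟩,
      fun x hx ↦ ⟨1, one_mem S, by rw [map_one, one_smul]; exact hx⟩⟩
  exact hid.ext_eq_zero S (fun N x ↦ x.eq_zero_of_hasProjectiveDimensionLT (n + 1) hi) Y x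

variable {κ : Type*} (S : κ → Submonoid R) {A' : κ → Type u} [∀ k, Ring (A' k)]
  [∀ k, Algebra R (A' k)] (φ : ∀ k, A →ₐ[R] A' k)
  [hφ : ∀ k, IsLocalizedModule (S k) (φ k).toLinearMap]
  (hS : ∀ J : Ideal R, (∀ k, ∃ s ∈ S k, s ∈ J) → J = ⊤)

include hS

theorem eq_zero_of_forall_exists_smul {M : Type*} [AddCommGroup M] [Module A M] {x : M}
    (h : ∀ k, ∃ s ∈ S k, algebraMap R A s • x = 0) : x = 0 := by
  let J : Ideal R :=
    { carrier := {r | algebraMap R A r • x = 0}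
      add_mem' := fun {r s} hr hs ↦ by
        rw [Set.mem_ofPred_eq] at hr hs ⊢
        rw [map_add, add_smul, hr, hs, add_zero]
      zero_mem' := by rw [Set.mem_ofPred_eq, map_zero, zero_smul]
      smul_mem' := fun r s hs ↦ by
        rw [Set.mem_ofPred_eq] at hs ⊢
        rw [smul_eq_mul, map_mul, mul_smul, hs, smul_zero] }
  have h1 : (1 : R) ∈ J := (Ideal.eq_top_iff_one J).mp (hS J h)
  simpa using (show algebraMap R A 1 • x = 0 from h1)

include hφ

/-- An element of Ext^j(N, A) vanishes in each localization, where N generates a submodule that is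
subject to the Auslander condition. Its annihilator in R meets every `S k`, hence is the unit ideal.
-/
theorem AuslanderCondition.of_forall [IsNoetherianRing A] [IsNoetherianRing Aᵐᵒᵖ]
    (h : ∀ k, AuslanderCondition (A' k)) : AuslanderCondition A := by
  intro M _ i N
  rw [le_grade_iff]
  intro j hj
  refine subsingleton_of_forall_eq 0 fun x ↦ ?_
  refine eq_zero_of_forall_exists_smul (A := Aᵐᵒᵖᵐᵒᵖ) S hS fun k ↦ ?_
  have := isLocalizedModule_op (S k) (φ := φ k)
  have := isNoetherianRing_of_isLocalizedModule (S k) (φ k)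
  obtain ⟨M', m, hm⟩ := exists_isLocMap (S k) (φ k) M
  have := hm.finite
  obtain ⟨Φ, hΦ⟩ := hm.exists_extToRing (S k) i
  obtain ⟨n, hn⟩ := hΦ.span (S k) N
  obtain ⟨Ψ, hΨ⟩ := hn.exists_extToRing (M := ModuleCat.of Aᵐᵒᵖ N)
    (M' := ModuleCat.of (A' k)ᵐᵒᵖ _) (S k) j
  have := le_grade_iff.mp (h k M' inferInstance i (.span _ (Φ '' N))) j hj
  exact hΨ.inj x (Subsingleton.elim _ _)

theorem hasProjectiveDimensionLE_of_forall [IsNoetherianRing A] (n : ℕ)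
    (h : ∀ (k) (M : ModuleCat.{u} (A' k)) [Module.Finite (A' k) M] (Y : ModuleCat.{u} (A' k))
      [Module.Finite (A' k) Y] (x : Ext M Y (n + 1)), x = 0) (M : ModuleCat.{u} A) :
    HasProjectiveDimensionLE M n := by
  refine hasProjectiveDimensionLE_of_forall_finite_finite n (fun M _ Y _ x ↦ ?_) M
  suffices hx : (Ext.mk₀ (centralEnd (1 : R) M)).comp x (zero_add _) = 0 by
    rwa [centralEnd_one, Ext.mk₀_id_comp] at hx
  let J : Ideal R :=
    { carrier := {r | (Ext.mk₀ (centralEnd r M)).comp x (zero_add _) = 0}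
      add_mem' := fun {r s} hr hs ↦ by
        rw [Set.mem_ofPred_eq] at hr hs ⊢
        rw [centralEnd_add, Ext.mk₀_add, Ext.add_comp, hr, hs, add_zero]
      zero_mem' := by rw [Set.mem_ofPred_eq, centralEnd_zero, Ext.mk₀_zero, Ext.zero_comp]
      smul_mem' := fun r s hs ↦ by
        rw [Set.mem_ofPred_eq] at hs ⊢
        rw [smul_eq_mul, mul_comm, centralEnd_mul, ← Ext.mk₀_comp_mk₀,
          Ext.comp_assoc_of_second_deg_zero, hs, Ext.comp_zero] }
  refine (Ideal.eq_top_iff_one J).mp (hS J fun k ↦ ?_)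
  obtain ⟨M', m, hm⟩ := exists_isLocMap (S k) (φ k) M
  obtain ⟨Y', ι, hι⟩ := exists_isLocMap (S k) (φ k) Y
  have := hm.finite
  have := hι.finite
  -- The image of x in Ext(M, Y') comes from Ext(M', Y') over the localization, which vanishes, so
  -- some denominator kills x.
  obtain ⟨y, hy⟩ := (hm.bijective_ext (S k) Y' (n + 1)).2
    (x.comp (Ext.mk₀ (toRes ι)) (add_zero _))
  rw [h k M' Y' y, map_zero] at hy
  obtain ⟨s, hs, h1⟩ := hι.ext_inj (S k) x hy.symm
  exact ⟨s, hs, (mk₀_centralEnd_comp s x).trans h1⟩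

end LocalGlobal

/-! ### Uniform annihilators of Ext and vanishing at a prime -/

section KillsExt

variable {R : Type u} (A : Type u) [CommRing R] [Ring A] [Algebra R A]
  {M M' : Type u} [AddCommGroup M] [Module A M] [AddCommGroup M'] [Module A M']

/-- The element `r` annihilates the groups `Ext^i_A(M, Y)` for all `Y`. -/
def KillsExt (r : R) (M : Type u) [AddCommGroup M] [Module A M] (i : ℕ) : Prop :=
  ∀ (Y : ModuleCat.{u} A) (x : Ext (ModuleCat.of A M) Y i),
    (Ext.mk₀ (centralEnd r (ModuleCat.of A M))).comp x (zero_add i) = 0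

variable {A}

/-- A map with kernel killed by `a` and cokernel killed by `b` has a quasi-inverse. -/
theorem exists_quasiInverse (u : M →ₗ[A] M') {a b : R}
    (ha : ∀ x, u x = 0 → algebraMap R A a • x = 0)
    (hb : ∀ y, ∃ x, algebraMap R A b • y = u x) :
    ∃ v : M' →ₗ[A] M, (∀ x, v (u x) = algebraMap R A (a * b) • x) ∧
      ∀ y, u (v y) = algebraMap R A (a * b) • y := by
  choose f hf using hb
  have key {x y : M} (h : u x = u y) : algebraMap R A a • x = algebraMap R A a • y := by
    rw [← sub_eq_zero, ← smul_sub]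
    exact ha _ (by rw [map_sub, h, sub_self])
  -- A chosen preimage of b • y is ambiguous up to the kernel of u, which a kills.
  refine ⟨{ toFun y := algebraMap R A a • f y, map_add' := fun y z ↦ ?_,
            map_smul' := fun c y ↦ ?_ }, fun x ↦ ?_, fun y ↦ ?_⟩
  · rw [← smul_add]
    exact key (by rw [map_add, ← hf, ← hf, ← hf, smul_add])
  · rw [RingHom.id_apply, smul_smul, ← Algebra.commutes, mul_smul]
    refine key ?_
    rw [map_smul, ← hf, ← hf, smul_smul, smul_smul, Algebra.commutes]
  · change algebraMap R A a • f (u x) = _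
    rw [map_mul, mul_smul]
    exact key (by rw [map_smul, hf])
  · change u (algebraMap R A a • f y) = _
    rw [map_smul, ← hf, map_mul, mul_smul]

theorem killsExt_of_smul_eq_zero {r : R} (h : ∀ m : M, algebraMap R A r • m = 0) (i : ℕ) :
    KillsExt A r M i := fun Y x ↦ by
  have : centralEnd r (ModuleCat.of A M) = 0 := by
    ext m
    exact h m
  rw [this, Ext.mk₀_zero, Ext.zero_comp]

theorem KillsExt.eq_zero {i : ℕ} (h : KillsExt A (1 : R) M i) {Y : ModuleCat.{u} A}
    (x : Ext (ModuleCat.of A M) Y i) : x = 0 := by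
  simpa [centralEnd_one] using h Y x

theorem KillsExt.mul_left {i : ℕ} {r : R} (h : KillsExt A r M i) (s : R) :
    KillsExt A (s * r) M i := fun Y x ↦ by
  rw [mul_comm, centralEnd_mul, ← Ext.mk₀_comp_mk₀, Ext.comp_assoc_of_second_deg_zero, h Y x,
    Ext.comp_zero]

theorem KillsExt.add {i : ℕ} {r s : R} (hr : KillsExt A r M i) (hs : KillsExt A s M i) :
    KillsExt A (r + s) M i := fun Y x ↦ by
  rw [centralEnd_add, Ext.mk₀_add, Ext.add_comp, hr Y x, hs Y x, add_zero]

theorem KillsExt.comp_mk₀ {i : ℕ} {r : R} (h : KillsExt A r M i) {Y : ModuleCat.{u} A}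
    (x : Ext (ModuleCat.of A M) Y i) :
    x.comp (Ext.mk₀ (centralEnd r Y)) (add_zero i) = 0 :=
  (mk₀_centralEnd_comp r x).symm.trans (h Y x)

/-- A class of degree i + 1 is a class of degree i with values in a cosyzygy, followed by an
extension class. This is where it matters that all Y are allowed. -/
theorem KillsExt.succ {i : ℕ} {r : R} (h : KillsExt A r M i) : KillsExt A r M (i + 1) := by
  intro Y x
  let I : InjectivePresentation Y := Classical.arbitrary _
  let S := ShortComplex.mk _ _ (Limits.cokernel.condition I.f)
  have hS : S.ShortExact := { exact := ShortComplex.exact_cokernel I.f }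
  have : Injective S.X₂ := I.injective
  obtain ⟨y, rfl⟩ := Ext.covariant_sequence_exact₁ _ hS x
    (Ext.eq_zero_of_injective (I := S.X₂) _) rfl
  rw [← Ext.comp_assoc _ _ _ (zero_add i) rfl (by lia), h _ y, Ext.zero_comp]

theorem KillsExt.mono {i j : ℕ} (hij : i ≤ j) {r : R} (h : KillsExt A r M i) :
    KillsExt A r M j := Nat.le_induction h (fun _ _ h ↦ h.succ) j hij

/-- If multiplication by `s` on `M'` factors through `M`, then `Ext^i(M', Y)` is controlled by
`Ext^i(M, Y)`. -/
theorem KillsExt.of_comp {i : ℕ} {r s : R} (h : KillsExt A r M i) (v : M' →ₗ[A] M)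
    (u : M →ₗ[A] M') (huv : ∀ y, u (v y) = algebraMap R A s • y) :
    KillsExt A (r * s) M' i := by
  intro Y x
  have : centralEnd (r * s) (ModuleCat.of A M') =
      ModuleCat.ofHom v ≫ centralEnd r (ModuleCat.of A M) ≫ ModuleCat.ofHom u := by
    ext y
    refine Eq.trans ?_ (u.map_smul (algebraMap R A r) (v y)).symm
    rw [huv, smul_smul, ← map_mul]
    rfl
  rw [this, ← Ext.mk₀_comp_mk₀, ← Ext.mk₀_comp_mk₀, Ext.comp_assoc_of_second_deg_zero,
    Ext.comp_assoc_of_second_deg_zero, h, Ext.comp_zero]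

/-- The short exact sequence of a submodule. -/
theorem shortExact_submodule (N : Submodule A M) :
    (ShortComplex.mk (ModuleCat.ofHom N.subtype) (ModuleCat.ofHom N.mkQ)
      (by ext x; exact (Submodule.Quotient.mk_eq_zero N).mpr x.2)).ShortExact where
  exact := (ShortComplex.ShortExact.moduleCat_exact_iff_function_exact _).mpr fun x ↦ by
    change N.mkQ x = 0 ↔ x ∈ Set.range N.subtype
    simp
  mono_f := (ModuleCat.mono_iff_injective _).mpr N.injective_subtype
  epi_g := (ModuleCat.epi_iff_surjective _).mpr N.mkQ_surjective

theorem mk₀_centralEnd_comp_mk₀_comp {X Y Z : ModuleCat.{u} A} (r : R) (f : X ⟶ Y) {i : ℕ}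
    (x : Ext Y Z i) :
    (Ext.mk₀ (centralEnd r X)).comp ((Ext.mk₀ f).comp x (zero_add i)) (zero_add i) =
      (Ext.mk₀ f).comp ((Ext.mk₀ (centralEnd r Y)).comp x (zero_add i)) (zero_add i) := by
  rw [← Ext.comp_assoc_of_second_deg_zero, ← Ext.comp_assoc_of_second_deg_zero,
    Ext.mk₀_comp_mk₀, Ext.mk₀_comp_mk₀, centralEnd_comp]

variable {r s : R} {N : Submodule A M} {i : ℕ}

/-- In the long exact sequence, annihilators of the two outer terms multiply to one of the middle
term. `KillsExt.left` and `KillsExt.right` are the same argument at the other places. -/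
theorem KillsExt.middle (hr : KillsExt A r N i) (hs : KillsExt A s (M ⧸ N) i) :
    KillsExt A (r * s) M i := by
  intro Y x
  have hS := shortExact_submodule N
  obtain ⟨y, hy⟩ := Ext.contravariant_sequence_exact₂ hS Y
    ((Ext.mk₀ (centralEnd r (ModuleCat.of A M))).comp x (zero_add i)) (by
      rw [← mk₀_centralEnd_comp_mk₀_comp]
      exact hr Y _)
  rw [centralEnd_mul, ← Ext.mk₀_comp_mk₀, Ext.comp_assoc_of_second_deg_zero, ← hy,
    mk₀_centralEnd_comp_mk₀_comp]
  exact (congrArg (Ext.comp _ · _) (hs Y y)).trans (Ext.comp_zero ..)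

theorem KillsExt.left (hr : KillsExt A r M i) (hs : KillsExt A s (M ⧸ N) (i + 1)) :
    KillsExt A (r * s) N i := by
  intro Y x
  have hS := shortExact_submodule N
  obtain ⟨y, hy⟩ := Ext.contravariant_sequence_exact₁ hS Y
    ((Ext.mk₀ (centralEnd s (ModuleCat.of A N))).comp x (zero_add i)) (add_comm 1 i) (by
      rw [mk₀_centralEnd_comp, ← Ext.comp_assoc_of_third_deg_zero]
      exact hs.comp_mk₀ _)
  rw [mul_comm, centralEnd_mul, ← Ext.mk₀_comp_mk₀, Ext.comp_assoc_of_second_deg_zero, ← hy,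
    mk₀_centralEnd_comp_mk₀_comp]
  exact (congrArg (Ext.comp _ · _) (hr Y y)).trans (Ext.comp_zero ..)

theorem KillsExt.right (hr : KillsExt A r N i) (hs : KillsExt A s M (i + 1)) :
    KillsExt A (r * s) (M ⧸ N) (i + 1) := by
  intro Y x
  have hS := shortExact_submodule N
  obtain ⟨y, hy⟩ := Ext.contravariant_sequence_exact₃ hS Y
    ((Ext.mk₀ (centralEnd s (ModuleCat.of A (M ⧸ N)))).comp x (zero_add _)) (by
      rw [← mk₀_centralEnd_comp_mk₀_comp]
      exact hs Y _) (add_comm 1 i)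
  rw [mul_comm, centralEnd_mul, ← Ext.mk₀_comp_mk₀, Ext.comp_assoc_of_second_deg_zero, ← hy,
    mk₀_centralEnd_comp, Ext.comp_assoc_of_third_deg_zero]
  exact (congrArg (Ext.comp _ · _) (hr.comp_mk₀ y)).trans (Ext.comp_zero ..)

/-- The groups `Ext^i_A(M, Y)` vanish at the prime `q` for all `Y`, uniformly in `Y`. -/
def VanishAt (q : Ideal R) (A : Type u) [Ring A] [Algebra R A] (M : Type u) [AddCommGroup M]
    [Module A M] (i : ℕ) : Prop := ∃ r ∉ q, KillsExt A r M i

section VanishAt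

variable {q : Ideal R} [hq : q.IsPrime]

omit hq in
theorem VanishAt.mono {i j : ℕ} (hij : i ≤ j) : VanishAt q A M i → VanishAt q A M j :=
  fun ⟨r, hr, h⟩ ↦ ⟨r, hr, h.mono hij⟩

omit hq in
theorem vanishAt_of_smul_eq_zero (hr : r ∉ q) (h : ∀ m : M, algebraMap R A r • m = 0) (i : ℕ) :
    VanishAt q A M i := ⟨r, hr, killsExt_of_smul_eq_zero h i⟩

include hq

theorem VanishAt.of_comp (h : VanishAt q A M i) (hs : s ∉ q) (v : M' →ₗ[A] M)
    (u : M →ₗ[A] M') (huv : ∀ y, u (v y) = algebraMap R A s • y) : VanishAt q A M' i := by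
  obtain ⟨r, hr, h⟩ := h
  exact ⟨_, hq.mul_notMem hr hs, h.of_comp v u huv⟩

/-- The map u is an isomorphism after localization at q, and its quasi-inverse factors
multiplication by a * b in both directions. -/
theorem vanishAt_congr (u : M →ₗ[A] M') {a b : R} (hqa : a ∉ q) (hqb : b ∉ q)
    (ha : ∀ x, u x = 0 → algebraMap R A a • x = 0)
    (hb : ∀ y, ∃ x, algebraMap R A b • y = u x) : VanishAt q A M i ↔ VanishAt q A M' i := by
  obtain ⟨v, hvu, huv⟩ := exists_quasiInverse u ha hb
  have hab := hq.mul_notMem hqa hqb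
  exact ⟨fun h ↦ h.of_comp hab v u huv, fun h ↦ h.of_comp hab u v hvu⟩

theorem VanishAt.middle (hr : VanishAt q A N i) (hs : VanishAt q A (M ⧸ N) i) :
    VanishAt q A M i := by
  obtain ⟨r, hr, h⟩ := hr
  obtain ⟨s, hs, h'⟩ := hs
  exact ⟨_, hq.mul_notMem hr hs, h.middle h'⟩

theorem VanishAt.left (hr : VanishAt q A M i) (hs : VanishAt q A (M ⧸ N) (i + 1)) :
    VanishAt q A N i := by
  obtain ⟨r, hr, h⟩ := hr
  obtain ⟨s, hs, h'⟩ := hs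
  exact ⟨_, hq.mul_notMem hr hs, h.left h'⟩

theorem VanishAt.right (hr : VanishAt q A N i) (hs : VanishAt q A M (i + 1)) :
    VanishAt q A (M ⧸ N) (i + 1) := by
  obtain ⟨r, hr, h⟩ := hr
  obtain ⟨s, hs, h'⟩ := hs
  exact ⟨_, hq.mul_notMem hr hs, h.right h'⟩

end VanishAt

end KillsExt

/-! ### Quasi-compactness, Nakayama's lemma and dévissage -/

section LocalVanishing

variable {R A : Type u} [CommRing R] [Ring A] [Algebra R A]

/-- Annihilators persist in higher degrees, so the elements that kill Ext^i(W, -) for some i form an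
ideal. It lies in no maximal ideal, hence contains 1: for a single module, pointwise bounds give a
global one. -/
theorem exists_killsExt_one {W : Type u} [AddCommGroup W] [Module A W]
    (h : ∀ q : Ideal R, q.IsPrime → ∃ i, VanishAt q A W i) :
    ∃ N, ∀ i, N ≤ i → KillsExt A (1 : R) W i := by
  let J : Ideal R :=
    { carrier := {r | ∃ i, KillsExt A r W i}
      add_mem' := fun {r s} ⟨i, hi⟩ ⟨j, hj⟩ ↦
        ⟨max i j, (hi.mono (le_max_left i j)).add (hj.mono (le_max_right i j))⟩
      zero_mem' := ⟨0, killsExt_of_smul_eq_zero (by simp) 0⟩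
      smul_mem' := fun c r ⟨i, hi⟩ ↦ ⟨i, hi.mul_left c⟩ }
  have hJ : J = ⊤ := by
    by_contra hJ
    obtain ⟨q, hq, hJq⟩ := Ideal.exists_le_maximal J hJ
    obtain ⟨i, r, hr, hi⟩ := h q hq.isPrime
    exact hr (hJq ⟨i, hi⟩)
  obtain ⟨N, hN⟩ : (1 : R) ∈ J := hJ ▸ Submodule.mem_top
  exact ⟨N, fun i hi ↦ hN.mono hi⟩

open Polynomial in
-- Cayley–Hamilton gives a monic Q, with lower coefficients in (x), annihilating xg. Dividing Q by X
-- - r shows that r - xg divides Q(r), which is a power of r modulo q and so lies outside q. The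
-- quotient is a polynomial in xg, hence A-linear.
theorem exists_determinant_trick [Module.Finite R A] {K : Type u} [AddCommGroup K] [Module A K]
    [Module.Finite A K] (q : Ideal R) [q.IsPrime] {x r : R} (hx : x ∈ q) (hr : r ∉ q)
    (g : K →ₗ[A] K) : ∃ u ∉ q, ∃ D : K →ₗ[A] K, ∀ k,
      D (algebraMap R A r • k - algebraMap R A x • g k) = algebraMap R A u • k := by
  let : Module R K := Module.compHom K (algebraMap R A)
  have : IsScalarTower R A K := ⟨fun r a x ↦ by rw [Algebra.smul_def, mul_smul]; rfl⟩
  have : Module.Finite R K := Module.Finite.trans A K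
  let f : Module.End R K := x • g.restrictScalars R
  obtain ⟨Q, hQ, -, hcoeff, h0⟩ :=
    LinearMap.exists_monic_and_natDegree_eq_and_coeff_mem_pow_and_aeval_eq_zero R f
      (Ideal.span {x}) (by
      rintro _ ⟨k, rfl⟩
      exact Submodule.smul_mem_smul (Ideal.mem_span_singleton_self x) Submodule.mem_top)
  let D := Q /ₘ (X - C r)
  have hD : C (Q.eval r) + (X - C r) * D = Q := by
    rw [← modByMonic_X_sub_C_eq_C_eval]
    exact modByMonic_add_div Q _
  have hcomm (P : R[X]) (a : A) (k : K) : aeval f P (a • k) = a • aeval f P k := by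
    have hf (k : K) : f (a • k) = a • f k := by
      change x • g (a • k) = a • x • g k
      rw [map_smul, smul_comm]
    induction P using Polynomial.induction_on' with
    | add P P' h h' => rw [map_add, LinearMap.add_apply, h, h', LinearMap.add_apply, smul_add]
    | monomial n c =>
      rw [aeval_monomial]
      simp only [Module.End.mul_apply, Module.algebraMap_end_apply]
      have (n : ℕ) : (f ^ n) (a • k) = a • (f ^ n) k := by
        induction n with
        | zero => simp
        | succ n ih => rw [pow_succ', Module.End.mul_apply, ih, hf, Module.End.mul_apply]
      rw [this, smul_comm]
  refine ⟨Q.eval r, fun hu ↦ ?_,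
    { toFun := aeval f D, map_add' := map_add _, map_smul' := hcomm D },
    fun k ↦ ?_⟩
  · rw [eval_eq_sum_range, Finset.sum_range_succ] at hu
    have : ∑ k ∈ Finset.range Q.natDegree, Q.coeff k * r ^ k ∈ q := by
      refine Ideal.sum_mem _ fun k hk ↦ Ideal.mul_mem_right _ _ ?_
      refine (Ideal.span_singleton_le_iff_mem q).mpr hx (Ideal.pow_le_self ?_ (hcoeff k))
      have := Finset.mem_range.mp hk
      lia
    rw [Ideal.add_mem_iff_right _ this, hQ.coeff_natDegree, one_mul] at hu
    exact hr (Ideal.IsPrime.mem_of_pow_mem ‹_› _ hu)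
  · have h1 := congr(aeval f $hD k)
    rw [h0, mul_comm] at h1
    simp only [map_add, map_mul, map_sub, aeval_C, aeval_X, LinearMap.add_apply,
      LinearMap.sub_apply, Module.End.mul_apply, Module.algebraMap_end_apply, LinearMap.zero_apply] at h1
    change aeval f D (r • k - x • g k) = eval r Q • k
    rw [add_eq_zero_iff_eq_neg] at h1
    rw [h1, ← map_sub, ← map_neg, neg_sub]
    rfl

variable [IsNoetherianRing R] [Module.Finite R A] {q : Ideal R} [hq : q.IsPrime]
  {M : Type u} [AddCommGroup M] [Module A M] [Module.Finite A M] {s : ℕ}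

include R in
theorem isNoetherianRing_of_finite_algebra : IsNoetherianRing A :=
  isNoetherian_of_tower R (inferInstanceAs (_root_.IsNoetherian R A))

/-- Nakayama's lemma for `Ext`. -/
theorem VanishAt.of_injective {x : R} (hxq : x ∈ q)
    (hx : ∀ m : M, algebraMap R A x • m = 0 → m = 0)
    (h : ∀ (N : Submodule A M), VanishAt q A (M ⧸ N) (s + 1)) : VanishAt q A M s := by
  have : IsNoetherianRing A := isNoetherianRing_of_finite_algebra (R := R)
  let c := (centralEnd x (ModuleCat.of A M)).hom
  have hS : (ShortComplex.mk (centralEnd x (ModuleCat.of A M))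
      (ModuleCat.ofHom (Y := ModuleCat.of A (M ⧸ LinearMap.range c)) (LinearMap.range c).mkQ) (by
        ext m; exact (Submodule.Quotient.mk_eq_zero _).mpr ⟨m, rfl⟩)).ShortExact :=
    { exact := (ShortComplex.ShortExact.moduleCat_exact_iff_function_exact _).mpr fun m ↦
        Submodule.Quotient.mk_eq_zero _
      mono_f := (ModuleCat.mono_iff_injective _).mpr ((injective_iff_map_eq_zero _).mpr hx)
      epi_g := (ModuleCat.epi_iff_surjective _).mpr (Submodule.mkQ_surjective _) }
  obtain ⟨r, hr, hrh⟩ := h (LinearMap.range c)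
  -- Nakayama is applied to the universal class rather than to Ext groups, which need not be finite.
  -- Since r kills Ext^{s+1}(M/xM, -), the class rη is x times some class ηg. So r - xg kills η, and
  -- the determinant trick turns it into a scalar u outside q.
  obtain ⟨K, F, j, η, hK, hF, hη⟩ := exists_universal_ext s (ModuleCat.of A M)
  obtain ⟨y, hy⟩ := Ext.contravariant_sequence_exact₁ hS K
    (η.comp (Ext.mk₀ (centralEnd r K)) (add_zero s)) (add_comm 1 s) (by
      rw [← Ext.comp_assoc_of_third_deg_zero]
      exact hrh.comp_mk₀ _)
  obtain ⟨g, rfl⟩ := (hη K).1 y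
  obtain ⟨u, hu, D, hD⟩ := exists_determinant_trick q hxq hr g.hom
  have h1 : centralEnd u K + (g ≫ centralEnd x K) ≫ ModuleCat.ofHom D =
      centralEnd r K ≫ ModuleCat.ofHom D := by
    ext k
    refine (congrArg (· + D (algebraMap R A x • g.hom k)) (hD k).symm).trans ?_
    exact (map_add D _ _).symm.trans (congrArg D (sub_add_cancel _ _))
  replace hy : η.comp (Ext.mk₀ (g ≫ centralEnd x K)) (add_zero s) =
      η.comp (Ext.mk₀ (centralEnd r K)) (add_zero s) := by
    rw [← hy, ← Ext.mk₀_comp_mk₀, ← Ext.comp_assoc_of_third_deg_zero]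
    exact (mk₀_centralEnd_comp x _).symm
  have hη0 : η.comp (Ext.mk₀ (centralEnd u K)) (add_zero s) = 0 := by
    have h2 := congr(η.comp (Ext.mk₀ $h1) (add_zero s))
    rw [Ext.mk₀_add, Ext.comp_add, ← Ext.mk₀_comp_mk₀ (g ≫ _), ← Ext.mk₀_comp_mk₀ (centralEnd r K),
      ← Ext.comp_assoc_of_third_deg_zero, ← Ext.comp_assoc_of_third_deg_zero, hy] at h2
    exact add_eq_right.mp h2
  refine ⟨u, hu, fun Y z ↦ ?_⟩
  obtain ⟨g', rfl⟩ := (hη Y).1 z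
  rw [← Ext.comp_assoc_of_third_deg_zero, mk₀_centralEnd_comp, hη0, Ext.zero_comp]

/-- Noetherian induction on an ideal I killing M. If I does not contain q, pick x in q outside I.
The x-power torsion of M is filtered by modules killed by I + (x), and on the quotient x is
injective, so `VanishAt.of_injective` applies. -/
theorem VanishAt.of_forall_succ
    (h : ∀ (M : Type u) [AddCommGroup M] [Module A M] [Module.Finite A M], VanishAt q A M (s + 1))
    (h0 : ∀ (M : Type u) [AddCommGroup M] [Module A M] [Module.Finite A M],
      (∀ r ∈ q, ∀ m : M, algebraMap R A r • m = 0) → VanishAt q A M s) : VanishAt q A M s := by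
  have : IsNoetherianRing A := isNoetherianRing_of_finite_algebra (R := R)
  suffices H : ∀ I : Ideal R, ∀ (M : Type u) [AddCommGroup M] [Module A M] [Module.Finite A M],
      (∀ r ∈ I, ∀ m : M, algebraMap R A r • m = 0) → VanishAt q A M s from
    H ⊥ M fun r hr m ↦ by rw [(Submodule.mem_bot R).mp hr, map_zero, zero_smul]
  intro I
  induction I using IsNoetherian.induction with
  | hgt I ih =>
  intro M _ _ _ hM
  by_cases hqI : q ≤ I
  · exact h0 M fun r hr ↦ hM r (hqI hr)
  obtain ⟨x, hxq, hxI⟩ := SetLike.not_le_iff_exists.mp hqI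
  have hlt : I < I ⊔ Ideal.span {x} := by
    refine lt_of_le_of_ne le_sup_left fun h ↦ hxI ?_
    rw [h]
    exact Ideal.mem_sup_right (Ideal.mem_span_singleton_self x)
  have hnil : ∀ (k : ℕ) (M : Type u) [AddCommGroup M] [Module A M] [Module.Finite A M],
      (∀ r ∈ I, ∀ m : M, algebraMap R A r • m = 0) →
      (∀ m : M, algebraMap R A (x ^ k) • m = 0) → VanishAt q A M s := by
    intro k
    induction k with
    | zero =>
      exact fun M _ _ _ _ h ↦
        vanishAt_of_smul_eq_zero (r := 1) hq.one_notMem (by simpa using h) s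
    | succ k ihk =>
      intro M _ _ _ hM hk
      let N := LinearMap.ker (centralEnd x (ModuleCat.of A M)).hom
      have hN : VanishAt q A N s := by
        refine ih _ hlt N fun r hr n ↦ ?_
        obtain ⟨a, ha, b, hb, rfl⟩ := Submodule.mem_sup.mp hr
        obtain ⟨c, rfl⟩ := Ideal.mem_span_singleton'.mp hb
        refine Subtype.ext ?_
        have : algebraMap R A x • (n : M) = 0 := n.2
        change algebraMap R A (a + c * x) • (n : M) = 0
        rw [map_add, add_smul, hM a ha, map_mul, mul_smul, this, smul_zero, add_zero]
      refine VanishAt.middle (N := N) hN (ihk (M ⧸ N) (fun r hr m ↦ ?_) fun m ↦ ?_)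
      · obtain ⟨m, rfl⟩ := N.mkQ_surjective m
        rw [← map_smul, hM r hr, map_zero]
      · obtain ⟨m, rfl⟩ := N.mkQ_surjective m
        rw [← map_smul]
        refine (Submodule.Quotient.mk_eq_zero N).mpr ?_
        change algebraMap R A x • algebraMap R A (x ^ k) • m = 0
        rw [smul_smul, ← map_mul, ← pow_succ', hk]
  let N : ℕ →o Submodule A M :=
    ⟨fun k ↦ LinearMap.ker (centralEnd (x ^ k) (ModuleCat.of A M)).hom,
      monotone_nat_of_le_succ fun k m hm ↦ by
        change algebraMap R A (x ^ (k + 1)) • m = 0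
        replace hm : algebraMap R A (x ^ k) • m = 0 := hm
        rw [pow_succ', map_mul, mul_smul, hm, smul_zero]⟩
  -- Once the kernels of the powers of x stabilize at k, x is injective modulo `N k`.
  obtain ⟨k, hk⟩ := monotone_stabilizes_iff_noetherian.mpr inferInstance N
  refine VanishAt.middle (N := N k) (hnil k (N k) (fun r hr n ↦ Subtype.ext (hM r hr n))
    fun n ↦ Subtype.ext n.2) (VanishAt.of_injective hxq (fun m hm ↦ ?_) fun _ ↦ h _)
  obtain ⟨m, rfl⟩ := (N k).mkQ_surjective m
  rw [← map_smul] at hm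
  have h1 : algebraMap R A (x ^ k) • algebraMap R A x • m = 0 :=
    (Submodule.Quotient.mk_eq_zero (N k)).mp hm
  refine (Submodule.Quotient.mk_eq_zero (N k)).mpr ?_
  rw [hk (k + 1) k.le_succ]
  change algebraMap R A (x ^ (k + 1)) • m = 0
  rw [pow_succ, map_mul, mul_smul, h1]

end LocalVanishing

/-! ### Coinduced modules -/

section Coinduced

variable {R : Type u} [CommRing R]

/-- The left `A`-module `Hom_R(A, E)` coinduced by an `R`-module `E`. -/
def Coinduced (R A E : Type u) [CommRing R] [Ring A] [Algebra R A] [AddCommGroup E] [Module R E] :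
    Type u := A →ₗ[R] E

namespace Coinduced

variable {A E E' : Type u} [Ring A] [Algebra R A] [AddCommGroup E] [Module R E]
  [AddCommGroup E'] [Module R E']

instance : AddCommGroup (Coinduced R A E) := inferInstanceAs (AddCommGroup (A →ₗ[R] E))

instance : Module R (Coinduced R A E) := inferInstanceAs (Module R (A →ₗ[R] E))

instance : FunLike (Coinduced R A E) A E := inferInstanceAs (FunLike (A →ₗ[R] E) A E)

instance : Module A (Coinduced R A E) where
  smul a φ := LinearMap.comp φ (LinearMap.mulRight R a)
  one_smul φ := LinearMap.ext fun c ↦ congrArg φ (mul_one c)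
  mul_smul a b φ := LinearMap.ext fun c ↦ congrArg φ (mul_assoc c a b).symm
  smul_zero _ := rfl
  smul_add _ _ _ := rfl
  add_smul a b φ := LinearMap.ext fun c ↦
    (congrArg φ (mul_add c a b)).trans (map_add (show A →ₗ[R] E from φ) _ _)
  zero_smul φ := LinearMap.ext fun c ↦
    (congrArg φ (mul_zero c)).trans (map_zero (show A →ₗ[R] E from φ))

theorem smul_apply (a c : A) (φ : Coinduced R A E) : (a • φ) c = φ (c * a) := rfl

theorem algebraMap_smul (r : R) (φ : Coinduced R A E) : algebraMap R A r • φ = r • φ :=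
  LinearMap.ext fun c ↦ by
    refine Eq.trans ?_ ((show A →ₗ[R] E from φ).map_smul r c)
    refine congrArg φ ?_
    rw [LinearMap.mulRight_apply, ← Algebra.commutes, Algebra.smul_def]

theorem algebraMap_smul_apply (r : R) (φ : Coinduced R A E) (c : A) :
    (algebraMap R A r • φ) c = r • φ c := by
  rw [algebraMap_smul]; rfl

instance : IsScalarTower R A (Coinduced R A E) := ⟨fun r a φ ↦ by
  rw [← algebraMap_smul r (a • φ), smul_smul, Algebra.smul_def]⟩

instance [IsNoetherianRing R] [Module.Finite R A] [Module.Finite R E] :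
    Module.Finite A (Coinduced R A E) := by
  have : Module.Finite R (Coinduced R A E) := inferInstanceAs (Module.Finite R (A →ₗ[R] E))
  exact Module.Finite.of_restrictScalars_finite R A _

/-- The functoriality of `Hom_R(A, E)` in `E`. -/
def map (A : Type u) [Ring A] [Algebra R A] (h : E →ₗ[R] E') :
    Coinduced R A E →ₗ[A] Coinduced R A E' where
  toFun φ := LinearMap.comp h φ
  map_add' φ ψ := LinearMap.comp_add φ ψ h
  map_smul' _ _ := rfl

end Coinduced

end Coinduced

/-! ### Generic freeness -/

section GenericFreeness

variable {R : Type u} [CommRing R]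

/-- Generic freeness of a finite module over `R ⧸ p`. -/
theorem exists_generic_section (p : Ideal R) [hp : p.IsPrime] (M : Type u) [AddCommGroup M]
    [Module R M] [Module.Finite R M] (hM : ∀ r ∈ p, ∀ m : M, r • m = 0) :
    ∃ f ∉ p, ∃ (ι : Type) (_ : Fintype ι) (α : (ι → R ⧸ p) →ₗ[R] M) (β : M →ₗ[R] (ι → R ⧸ p)),
      ∀ m, α (β m) = f • m := by
  classical
  have htors : Module.IsTorsionBySet R M p := fun m r ↦ hM r r.2 m
  let : Module (R ⧸ p) M := htors.module
  have : IsScalarTower R (R ⧸ p) M := htors.isScalarTower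
  obtain ⟨n, v, hv⟩ := Module.Finite.exists_fin (R := R) (M := M)
  -- A maximal independent subfamily of the generators spans a free submodule containing a multiple
  -- of each generator by an element outside p.
  obtain ⟨s, hli, hs⟩ := exists_maximal_linearIndepOn (R ⧸ p) v
  let T := (Submodule.span (R ⧸ p) (v '' s)).restrictScalars R
  obtain ⟨f, hf, hfv⟩ := exists_common_denominator p.primeCompl (fun i f ↦ f • v i ∈ T)
    (fun i f g h ↦ by rw [mul_smul]; exact T.smul_mem g h) fun i ↦ by
      by_cases hi : i ∈ s
      · exact ⟨1, one_mem _, T.smul_mem _ (Submodule.subset_span ⟨i, hi, rfl⟩)⟩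
      · obtain ⟨a, ha, h⟩ := hs i hi
        obtain ⟨a, rfl⟩ := Ideal.Quotient.mk_surjective a
        refine ⟨a, fun h0 ↦ ha (Ideal.Quotient.eq_zero_iff_mem.mpr h0), ?_⟩
        rw [← algebraMap_smul (R ⧸ p) a (v i)]
        exact h
  have hT (m : M) : f • m ∈ T := by
    have hm : m ∈ Submodule.span R (Set.range v) := hv ▸ Submodule.mem_top
    induction hm using Submodule.span_induction with
    | mem m hm => obtain ⟨i, rfl⟩ := hm; exact hfv i
    | zero => rw [smul_zero]; exact T.zero_mem
    | add m m' _ _ h h' => rw [smul_add]; exact T.add_mem h h'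
    | smul r m _ h => rw [smul_comm]; exact T.smul_mem r h
  let α := (Fintype.linearCombination (R ⧸ p) fun i : s ↦ v i).restrictScalars R
  have hα : Function.Injective α :=
    linearIndependent_iff_injective_fintypeLinearCombination.mp hli
  obtain ⟨β, -, hβ⟩ := exists_quasiInverse (R := R) α (a := 1) (b := f)
    (fun x hx ↦ by rw [hα (hx.trans (map_zero α).symm), smul_zero]) fun m ↦ by
      have h1 := hT m
      have h2 : f • m ∈ LinearMap.range (Fintype.linearCombination (R ⧸ p) fun i : s ↦ v i) := by
        rw [Fintype.range_linearCombination]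
        rwa [Set.range_comp', Subtype.range_coe]
      obtain ⟨x, hx⟩ := h2
      exact ⟨x, hx.symm⟩
  exact ⟨f, hf, s, inferInstance, α, β, fun m ↦ by rw [hβ, one_mul]; rfl⟩

/-- Up to f, the map A/pA → A/pA factors through a free R/p-module, from which maps lift along R/I →
R/J. The same f serves all I and J above p. -/
theorem exists_generic_lift (p : Ideal R) [p.IsPrime] (A : Type u) [AddCommGroup A] [Module R A]
    [Module.Finite R A] : ∃ f ∉ p, ∀ (I J : Ideal R) (_ : p ≤ I) (hIJ : I ≤ J)
      (φ : A →ₗ[R] R ⧸ J), ∃ ψ : A →ₗ[R] R ⧸ I, ∀ c, Submodule.factor hIJ (ψ c) = f • φ c := by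
  classical
  let P : Submodule R A := p • ⊤
  obtain ⟨f, hf, ι, _, α, β, h⟩ := exists_generic_section p (A ⧸ P) fun r hr m ↦ by
    obtain ⟨m, rfl⟩ := P.mkQ_surjective m
    rw [← map_smul]
    exact (Submodule.Quotient.mk_eq_zero P).mpr (Submodule.smul_mem_smul hr Submodule.mem_top)
  refine ⟨f, hf, fun I J hpI hIJ φ ↦ ?_⟩
  have hφ : P ≤ LinearMap.ker φ := Submodule.smul_le.mpr fun r hr c _ ↦ by
    rw [LinearMap.mem_ker, map_smul]
    obtain ⟨t, ht⟩ := Submodule.mkQ_surjective J (φ c)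
    rw [← ht, ← map_smul]
    exact (Submodule.Quotient.mk_eq_zero J).mpr (J.mul_mem_right t (hIJ (hpI hr)))
  let φ' := P.liftQ φ hφ
  choose t ht using fun i ↦ Submodule.factor_surjective hIJ (φ' (α (Pi.single i 1)))
  let ψ : (ι → R ⧸ p) →ₗ[R] R ⧸ I :=
    ∑ i, LinearMap.mulRight R (t i) ∘ₗ Submodule.factor hpI ∘ₗ LinearMap.proj i
  have hψ : Submodule.factor hIJ ∘ₗ ψ = φ' ∘ₗ α := by
    refine LinearMap.pi_ext' fun i ↦ Submodule.linearMap_qext _ (LinearMap.ext_ring ?_)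
    refine Eq.trans ?_ (ht i)
    change Submodule.factor hIJ (ψ (Pi.single i 1)) = _
    have : ψ (Pi.single i 1) = t i := by
      rw [LinearMap.sum_apply, Finset.sum_eq_single i]
      · simp only [LinearMap.comp_apply, LinearMap.proj_apply, Pi.single_eq_same]
        exact one_mul (t i)
      · intro j _ hj
        simp only [LinearMap.comp_apply, LinearMap.proj_apply, Pi.single_eq_of_ne hj, map_zero]
      · exact fun h ↦ (h (Finset.mem_univ i)).elim
    rw [this]
  refine ⟨ψ ∘ₗ β ∘ₗ P.mkQ, fun c ↦ ?_⟩
  have h1 := congr($hψ (β (P.mkQ c)))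
  rw [LinearMap.comp_apply, LinearMap.comp_apply, h, map_smul] at h1
  exact h1

end GenericFreeness

/-! ### Associated primes and regular elements -/

section Dichotomy

variable {R : Type u} [CommRing R] [IsNoetherianRing R]

/-- Either `q` is, after localization at `q`, an associated prime of `R ⧸ I`, or it contains an
element which is, after localization at `q`, regular on `R ⧸ I`. -/
theorem exists_colon_eq_or_exists_regular (I q : Ideal R) [hq : q.IsPrime] :
    (∃ t, ∀ r, r * t ∈ I ↔ r ∈ q) ∨ ∃ x ∈ q, ∃ a ∉ q, ∀ t, x * t ∈ I → a * t ∈ I := by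
  -- I' is the preimage in R of the localization of I at q. Over a Noetherian ring, a single
  -- denominator carries any ideal inside I' into I.
  let I' : Ideal R :=
    { carrier := {t | ∃ a ∉ q, a * t ∈ I}
      add_mem' := fun {t u} ⟨a, ha, h⟩ ⟨b, hb, h'⟩ ↦ ⟨a * b, hq.mul_notMem ha hb, by
        rw [show a * b * (t + u) = b * (a * t) + a * (b * u) by ring]
        exact I.add_mem (I.mul_mem_left _ h) (I.mul_mem_left _ h')⟩
      zero_mem' := ⟨1, hq.one_notMem, by simp⟩
      smul_mem' := fun c t ⟨a, ha, h⟩ ↦ ⟨a, ha, by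
        rw [smul_eq_mul, mul_left_comm]
        exact I.mul_mem_left _ h⟩ }
  have huniform (J : Ideal R) (hJ : J ≤ I') : ∃ a ∉ q, ∀ t ∈ J, a * t ∈ I := by
    obtain ⟨T, rfl⟩ := IsNoetherian.noetherian J
    obtain ⟨a, ha, h⟩ := exists_common_denominator q.primeCompl (fun (t : T) a ↦ a * t ∈ I)
      (fun t a b h ↦ by rw [mul_assoc]; exact I.mul_mem_left b h)
      fun t ↦ hJ (Submodule.subset_span t.2)
    refine ⟨a, ha, fun t ht ↦ ?_⟩
    have : Submodule.span R (T : Set R) ≤ Submodule.comap (LinearMap.mulLeft R a) I :=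
      Submodule.span_le.mpr fun t ht ↦ h ⟨t, ht⟩
    exact this ht
  -- Prime avoidance: if q consists of zero divisors on R/I', it lies in an associated prime, the
  -- annihilator of some t. A multiple of t by an element outside q then has colon exactly q with
  -- respect to I itself.
  by_cases hU : (q : Set R) ⊆ ⋃ P ∈ associatedPrimes R (R ⧸ I'), P
  · left
    rw [Ideal.subset_union_prime_finite (associatedPrimes.finite R (R ⧸ I')) ⊤ ⊤
      fun P hP _ _ ↦ hP.1] at hU
    obtain ⟨P, hP, hqP⟩ := hU
    obtain ⟨hP, t, rfl⟩ := isAssociatedPrime_iff.mp hP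
    obtain ⟨t, rfl⟩ := Ideal.Quotient.mk_surjective t
    have hmem (r : R) : r ∈ Submodule.colon (⊥ : Submodule R (R ⧸ I')) {Ideal.Quotient.mk I' t} ↔
        r * t ∈ I' := by
      rw [Submodule.mem_colon_singleton, Submodule.mem_bot, ← Ideal.Quotient.eq_zero_iff_mem]
      rfl
    have ht : t ∉ I' := fun ht ↦ hP.one_notMem ((hmem 1).mpr (by rwa [one_mul]))
    obtain ⟨a, ha, h⟩ := huniform (q * Ideal.span {t}) (by
      rw [Ideal.mul_le]
      intro r hr u hu
      obtain ⟨c, rfl⟩ := Ideal.mem_span_singleton'.mp hu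
      rw [mul_left_comm]
      exact I'.mul_mem_left c ((hmem r).mp (hqP hr)))
    refine ⟨a * t, fun r ↦ ⟨fun hr ↦ ?_, fun hr ↦ ?_⟩⟩
    · by_contra hrq
      exact ht ⟨r * a, hq.mul_notMem hrq ha, by rwa [mul_assoc]⟩
    · rw [mul_left_comm]
      exact h _ (Ideal.mul_mem_mul hr (Ideal.mem_span_singleton_self t))
  · right
    obtain ⟨x, hxq, hx⟩ := Set.not_subset.mp hU
    rw [biUnion_associatedPrimes_eq_zero_divisors] at hx
    obtain ⟨a, ha, h⟩ := huniform (Submodule.comap (LinearMap.mulLeft R x) I) fun t ht ↦ by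
      by_contra htI
      refine hx ⟨Ideal.Quotient.mk I' t, fun h0 ↦ htI (Ideal.Quotient.eq_zero_iff_mem.mp h0), ?_⟩
      refine Ideal.Quotient.eq_zero_iff_mem.mpr ⟨1, hq.one_notMem, ?_⟩
      rw [one_mul]
      exact ht
    exact ⟨x, hxq, a, ha, fun t ht ↦ h t ht⟩

/-- A minimal prime over I is associated to R/I. It cannot contain x, because x is regular on R/I up
to an element outside q; so a minimal prime over I below P differs from P. -/
theorem exists_prime_lt_of_regular {I q : Ideal R} {x a : R} (ha : a ∉ q)
    (h : ∀ t, x * t ∈ I → a * t ∈ I) {P : Ideal R} [P.IsPrime] (hIP : I ⊔ Ideal.span {x} ≤ P)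
    (hPq : P ≤ q) : ∃ P' : Ideal R, P'.IsPrime ∧ I ≤ P' ∧ P' < P := by
  obtain ⟨P', hP', hle⟩ := Ideal.exists_minimalPrimes_le (le_sup_left.trans hIP)
  refine ⟨P', hP'.1.1, hP'.1.2, lt_of_le_of_ne hle ?_⟩
  rintro rfl
  have hass := Module.associatedPrimes.minimalPrimes_annihilator_subset_associatedPrimes R (R ⧸ I)
    (by rwa [Ideal.annihilator_quotient] : P' ∈ _)
  obtain ⟨-, t, ht⟩ := isAssociatedPrime_iff.mp hass
  obtain ⟨t, rfl⟩ := Ideal.Quotient.mk_surjective t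
  have hmem (r : R) : r ∈ P' ↔ r * t ∈ I := by
    rw [ht, Submodule.mem_colon_singleton, Submodule.mem_bot, ← Ideal.Quotient.eq_zero_iff_mem]
    rfl
  exact ha (hPq ((hmem a).mpr (h t ((hmem x).mp
    (hIP (Ideal.mem_sup_right (Ideal.mem_span_singleton_self x)))))))

end Dichotomy

/-! ### A uniform bound for the local global dimensions -/

section UniformBound

variable {R A : Type u} [CommRing R] [Ring A] [Algebra R A] {q : Ideal R} [hq : q.IsPrime]
  {M₁ M₂ M₃ : Type u} [AddCommGroup M₁] [Module A M₁] [AddCommGroup M₂] [Module A M₂]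
  [AddCommGroup M₃] [Module A M₃] {i : ℕ}

include hq in
-- The sequence 0 → M₁ → M₂ → M₃ → 0 is exact after localization at q, with denominators a, b and c.
theorem VanishAt.of_quasiExact (f : M₁ →ₗ[A] M₂) (g : M₂ →ₗ[A] M₃) (hgf : ∀ x, g (f x) = 0)
    {a b c : R} (ha : a ∉ q) (hb : b ∉ q) (hc : c ∉ q)
    (hf : ∀ x, f x = 0 → algebraMap R A a • x = 0)
    (hfg : ∀ y, g y = 0 → ∃ x, algebraMap R A b • y = f x)
    (hg : ∀ z, ∃ y, algebraMap R A c • z = g y)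
    (h₁ : VanishAt q A M₁ i) (h₂ : VanishAt q A M₂ (i + 1)) : VanishAt q A M₃ (i + 1) := by
  let N := LinearMap.ker g
  have hN : VanishAt q A N i :=
    (vanishAt_congr (f.codRestrict N hgf) ha hb (fun x hx ↦ hf x (congrArg Subtype.val hx))
      fun y ↦ (hfg y y.2).imp fun x hx ↦ Subtype.ext hx).mp h₁
  refine (vanishAt_congr (N.liftQ g le_rfl) hq.one_notMem hc (fun x hx ↦ ?_) fun z ↦ ?_).mp
    (hN.right h₂)
  · obtain ⟨x, rfl⟩ := N.mkQ_surjective x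
    have : N.mkQ x = 0 := (Submodule.Quotient.mk_eq_zero N).mpr hx
    rw [this, smul_zero]
  · obtain ⟨y, hy⟩ := hg z
    exact ⟨N.mkQ y, hy⟩

omit hq in
theorem VanishAt.pi {ι : Type} [Finite ι] (h : VanishAt q A M₁ i) : VanishAt q A (ι → M₁) i := by
  classical
  cases nonempty_fintype ι
  obtain ⟨r, hr, h⟩ := h
  refine ⟨r, hr, fun Y x ↦ ?_⟩
  let P := ModuleCat.of A (ι → M₁)
  let π (k : ι) : P ⟶ ModuleCat.of A M₁ := ModuleCat.ofHom (LinearMap.proj k)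
  let j (k : ι) : ModuleCat.of A M₁ ⟶ P := ModuleCat.ofHom (LinearMap.single A (fun _ ↦ M₁) k)
  let F : (P ⟶ P) →+ Ext P Y i :=
    { toFun e := (Ext.mk₀ e).comp x (zero_add i)
      map_zero' := by rw [Ext.mk₀_zero, Ext.zero_comp]
      map_add' e e' := by rw [Ext.mk₀_add, Ext.add_comp] }
  have hsum : centralEnd r P = ∑ k, π k ≫ centralEnd r (ModuleCat.of A M₁) ≫ j k := by
    refine ModuleCat.hom_ext (LinearMap.ext fun y ↦ ?_)
    rw [ModuleCat.hom_sum, LinearMap.sum_apply]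
    exact (Finset.univ_sum_single (fun k ↦ algebraMap R A r • y k)).symm
  change F (centralEnd r P) = 0
  rw [hsum, map_sum]
  refine Finset.sum_eq_zero fun k _ ↦ ?_
  change (Ext.mk₀ (π k ≫ centralEnd r _ ≫ j k)).comp x (zero_add i) = 0
  rw [← Ext.mk₀_comp_mk₀, ← Ext.mk₀_comp_mk₀, Ext.comp_assoc_of_second_deg_zero,
    Ext.comp_assoc_of_second_deg_zero, h, Ext.comp_zero]

variable [IsNoetherianRing R] [Module.Finite R A]

omit [IsNoetherianRing R] [Module.Finite R A] in
-- Apply Hom_R(A, -) to multiplication by x on R/I with cokernel R/(I + (x)). Up to elements outside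
-- q this stays short exact: a handles the left and the middle, and f repairs the missing right
-- exactness.
theorem VanishAt.coinduced_sup {p I : Ideal R} {f x a : R} (hf : f ∉ q) (ha : a ∉ q) (hpI : p ≤ I)
    (hlift : ∀ (I J : Ideal R) (_ : p ≤ I) (hIJ : I ≤ J) (φ : A →ₗ[R] R ⧸ J),
      ∃ ψ : A →ₗ[R] R ⧸ I, ∀ c, Submodule.factor hIJ (ψ c) = f • φ c)
    (hx : ∀ t, x * t ∈ I → a * t ∈ I) (h : VanishAt q A (Coinduced R A (R ⧸ I)) i) :
    VanishAt q A (Coinduced R A (R ⧸ (I ⊔ Ideal.span {x}))) (i + 1) := by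
  let J := I ⊔ Ideal.span {x}
  have hIJ : I ≤ J := le_sup_left
  have hx' (e : R ⧸ I) (he : x • e = 0) : a • e = 0 := by
    obtain ⟨t, rfl⟩ := Submodule.mkQ_surjective I e
    rw [← map_smul] at he ⊢
    exact (Submodule.Quotient.mk_eq_zero I).mpr (hx t ((Submodule.Quotient.mk_eq_zero I).mp he))
  let π := Submodule.factor hIJ
  have hπ (e : R ⧸ I) : π (x • e) = 0 := by
    obtain ⟨t, rfl⟩ := Submodule.mkQ_surjective I e
    rw [← map_smul]
    exact (Submodule.Quotient.mk_eq_zero J).mpr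
      (Ideal.mem_sup_right (Ideal.mul_mem_right t _ (Ideal.mem_span_singleton_self x)))
  have hπ' (e : R ⧸ I) (he : π e = 0) : ∃ e', x • e' = e := by
    obtain ⟨t, rfl⟩ := Submodule.mkQ_surjective I e
    obtain ⟨s, hs, y, hy, rfl⟩ := Submodule.mem_sup.mp ((Submodule.Quotient.mk_eq_zero J).mp he)
    obtain ⟨c, rfl⟩ := Ideal.mem_span_singleton'.mp hy
    refine ⟨I.mkQ c, ?_⟩
    rw [map_add, ← map_smul, smul_eq_mul, mul_comm x c,
      (Submodule.Quotient.mk_eq_zero I).mpr hs |> (show I.mkQ s = 0 from ·), zero_add]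
  let u : (R ⧸ I) →ₗ[R] LinearMap.ker π :=
    (LinearMap.lsmul R (R ⧸ I) x).codRestrict _ fun e ↦ hπ e
  obtain ⟨v, -, hv⟩ := exists_quasiInverse (R := R) u (a := a) (b := 1)
    (fun e he ↦ hx' e (congrArg Subtype.val he)) fun y ↦ by
      obtain ⟨e, he⟩ := hπ' y y.2
      exact ⟨e, Subtype.ext (by rw [map_one, one_smul]; exact he.symm)⟩
  refine VanishAt.of_quasiExact (centralEnd x (ModuleCat.of A (Coinduced R A (R ⧸ I)))).hom
    (Coinduced.map A π) (fun φ ↦ LinearMap.ext fun c ↦ ?_) ha (hq.mul_notMem ha hq.one_notMem) hf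
    (fun φ hφ ↦ LinearMap.ext fun c ↦ ?_) (fun φ hφ ↦ ?_) (fun φ ↦ ?_) h
    (h.mono i.le_succ)
  · refine (congrArg π (Coinduced.algebraMap_smul_apply x φ c)).trans (hπ _)
  · refine (Coinduced.algebraMap_smul_apply a φ c).trans (hx' _ ?_)
    exact (Coinduced.algebraMap_smul_apply x φ c).symm.trans congr($hφ c)
  · refine ⟨v ∘ₗ LinearMap.codRestrict (LinearMap.ker π) φ fun c ↦ congr($hφ c),
      LinearMap.ext fun c ↦ (Coinduced.algebraMap_smul_apply _ φ c).trans ?_⟩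
    refine Eq.trans ?_ (Coinduced.algebraMap_smul_apply x _ c).symm
    exact (congrArg Subtype.val (hv ⟨φ c, congr($hφ c)⟩)).symm
  · obtain ⟨ψ, hψ⟩ := hlift I J hpI hIJ φ
    exact ⟨ψ, LinearMap.ext fun c ↦
      (Coinduced.algebraMap_smul_apply _ φ c).trans (hψ c).symm⟩

/-- Multiplication by t embeds R/q in R/I. Composed with a generic embedding of M in a power of R/q,
its adjoint is an A-linear map from M to a power of Hom_R(A, R/I) with kernel killed by f. The
cokernel is controlled in degree i + 1 by `hsucc`. -/
theorem VanishAt.of_colon_eq {I : Ideal R} {t : R} (ht : ∀ r, r * t ∈ I ↔ r ∈ q)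
    (h : VanishAt q A (Coinduced R A (R ⧸ I)) i)
    (hsucc : ∀ (M : Type u) [AddCommGroup M] [Module A M] [Module.Finite A M],
      VanishAt q A M (i + 1))
    (M : Type u) [AddCommGroup M] [Module A M] [Module.Finite A M]
    (hM : ∀ r ∈ q, ∀ m : M, algebraMap R A r • m = 0) : VanishAt q A M i := by
  let : Module R M := Module.compHom M (algebraMap R A)
  have : IsScalarTower R A M := ⟨fun r a x ↦ by rw [Algebra.smul_def, mul_smul]; rfl⟩
  have : Module.Finite R M := Module.Finite.trans A M
  obtain ⟨f, hf, ι, _, α, β, hαβ⟩ := exists_generic_section q M hM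
  let j : R ⧸ q →ₗ[R] R ⧸ I := q.liftQ (LinearMap.toSpanSingleton R _ (I.mkQ t)) fun r hr ↦ by
    change r • I.mkQ t = 0
    rw [← map_smul]
    exact (Submodule.Quotient.mk_eq_zero I).mpr ((ht r).mpr hr)
  have hj : ∀ e, j e = 0 → e = 0 := fun e he ↦ by
    obtain ⟨r, rfl⟩ := Submodule.mkQ_surjective q e
    refine (Submodule.Quotient.mk_eq_zero q).mpr ((ht r).mp ?_)
    refine (Submodule.Quotient.mk_eq_zero I).mp ?_
    exact he
  let u : M →ₗ[A] (ι → Coinduced R A (R ⧸ I)) :=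
    { toFun m k := j ∘ₗ LinearMap.proj k ∘ₗ β ∘ₗ (LinearMap.toSpanSingleton A M m).restrictScalars R
      map_add' m m' := by
        refine funext fun k ↦ LinearMap.ext fun c ↦ ?_
        change j (β (c • (m + m')) k) = j (β (c • m) k) + j (β (c • m') k)
        rw [smul_add, map_add, Pi.add_apply, map_add]
      map_smul' a m := by
        refine funext fun k ↦ LinearMap.ext fun c ↦ ?_
        change j (β (c • a • m) k) = j (β ((c * a) • m) k)
        rw [mul_smul] }
  refine (vanishAt_congr u.rangeRestrict hf hq.one_notMem (fun m hm ↦ ?_) fun y ↦ ?_).mpr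
    (VanishAt.left h.pi (hsucc _))
  · refine (hαβ m).symm.trans ((congrArg α (funext fun k ↦ hj _ ?_)).trans (map_zero α))
    have h1 := congr($(congrFun (congrArg Subtype.val hm) k) 1)
    replace h1 : j (β ((1 : A) • m) k) = 0 := h1
    rwa [one_smul] at h1
  · obtain ⟨x, hx⟩ := u.surjective_rangeRestrict y
    exact ⟨x, by rw [map_one, one_smul, hx]⟩

/-- If q is not yet associated to R/I locally, I is enlarged by an element regular on R/I locally at
q. Every chain of primes from the new ideal to q can be prolonged downwards, so d drops by one while
i grows by one, and i + d ≤ s persists. -/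
theorem VanishAt.of_chains {p : Ideal R} {f : R} (hf : f ∉ q)
    (hlift : ∀ (I J : Ideal R) (_ : p ≤ I) (hIJ : I ≤ J) (φ : A →ₗ[R] R ⧸ J),
      ∃ ψ : A →ₗ[R] R ⧸ I, ∀ c, Submodule.factor hIJ (ψ c) = f • φ c)
    {s : ℕ} (hsucc : ∀ (M : Type u) [AddCommGroup M] [Module A M] [Module.Finite A M],
      VanishAt q A M (s + 1)) (d : ℕ) : ∀ (I : Ideal R) (i : ℕ), p ≤ I → I ≤ q →
    (∀ l : LTSeries (PrimeSpectrum R), I ≤ l.head.asIdeal → l.last.asIdeal ≤ q → l.length ≤ d) →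
    VanishAt q A (Coinduced R A (R ⧸ I)) i → i + d ≤ s →
    ∀ (M : Type u) [AddCommGroup M] [Module A M] [Module.Finite A M],
      (∀ r ∈ q, ∀ m : M, algebraMap R A r • m = 0) → VanishAt q A M s := by
  induction d using Nat.strong_induction_on with
  | h d ih =>
  intro I i hpI hIq hd hI hs M _ _ _ hM
  obtain ⟨t, ht⟩ | ⟨x, hxq, a, ha, hx⟩ := exists_colon_eq_or_exists_regular I q
  · exact (hI.mono (le_of_add_le_left hs)).of_colon_eq ht hsucc M hM
  let J := I ⊔ Ideal.span {x}
  have hJq : J ≤ q := sup_le hIq ((Ideal.span_singleton_le_iff_mem q).mpr hxq)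
  have hJ (l : LTSeries (PrimeSpectrum R)) (h₁ : J ≤ l.head.asIdeal)
      (h₂ : l.last.asIdeal ≤ q) : l.length + 1 ≤ d := by
    obtain ⟨P, hP, hIP, hlt⟩ := exists_prime_lt_of_regular ha hx h₁
      (le_trans (LTSeries.head_le_last l) h₂)
    rw [← RelSeries.cons_length l ⟨P, hP⟩ hlt]
    exact hd (l.cons ⟨P, hP⟩ hlt) (by simpa using hIP) (by simpa using h₂)
  have hd1 := hJ (RelSeries.singleton _ ⟨q, hq⟩) hJq le_rfl
  refine ih (d - 1) (by lia) J (i + 1) (hpI.trans le_sup_left) hJq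
    (fun l h₁ h₂ ↦ by have := hJ l h₁ h₂; lia) (hI.coinduced_sup hf ha hpI hlift hx) (by lia) M hM

omit hq in
variable (A) in
/-- If every localization of `A` at a prime of `R` has finite global dimension, and `R` has finite
Krull dimension, then the global dimensions of these localizations are bounded. -/
theorem exists_forall_vanishAt (d : ℕ) (hd : ∀ l : LTSeries (PrimeSpectrum R), l.length ≤ d)
    (h : ∀ q : Ideal R, q.IsPrime → ∃ n, ∀ (M : Type u) [AddCommGroup M] [Module A M]
      [Module.Finite A M], VanishAt q A M n) :
    ∃ n, ∀ q : Ideal R, q.IsPrime → ∀ (M : Type u) [AddCommGroup M] [Module A M]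
      [Module.Finite A M], VanishAt q A M n := by
  suffices H : ∀ J : Ideal R, ∃ n, ∀ q : Ideal R, q.IsPrime → J ≤ q →
      ∀ (M : Type u) [AddCommGroup M] [Module A M] [Module.Finite A M], VanishAt q A M n by
    obtain ⟨n, hn⟩ := H ⊥
    exact ⟨n, fun q hq ↦ hn q hq bot_le⟩
  intro J
  induction J using IsNoetherian.induction with
  | hgt J ih =>
  by_cases hJ : Ideal.IsPrime J
  · obtain ⟨f, hf, hlift⟩ := exists_generic_lift J A
    -- Only the one module Hom_R(A, R/J) is used, so its pointwise bounds combine to an i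
    -- independent of q.
    obtain ⟨i, hi⟩ := exists_killsExt_one (R := R) (W := Coinduced R A (R ⧸ J)) fun q hq ↦
      (h q hq).imp fun n hn ↦ hn _
    obtain ⟨n₁, hn₁⟩ := ih (J ⊔ Ideal.span {f}) (lt_of_le_of_ne le_sup_left fun h ↦ hf (by
      rw [h]
      exact Ideal.mem_sup_right (Ideal.mem_span_singleton_self f)))
    refine ⟨max n₁ (i + d), fun q hq hJq M _ _ _ ↦ ?_⟩
    by_cases hfq : f ∈ q
    · exact (hn₁ q hq (sup_le hJq ((Ideal.span_singleton_le_iff_mem q).mpr hfq)) M).mono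
        (le_max_left _ _)
    obtain ⟨n₂, hn₂⟩ := h q hq
    -- Descending induction on s: k bounds its distance from the bound n₂ at q, which may depend on
    -- q, down to i + d, which does not.
    have key (k : ℕ) : ∀ s, i + d ≤ s → n₂ ≤ s + k → ∀ (M : Type u) [AddCommGroup M] [Module A M]
        [Module.Finite A M], VanishAt q A M s := by
      induction k with
      | zero => exact fun s _ hs M _ _ _ ↦ (hn₂ M).mono hs
      | succ k ihk =>
        intro s hs hsk M _ _ _
        have hsucc := ihk (s + 1) (by lia) (by lia)
        exact VanishAt.of_forall_succ hsucc fun M _ _ _ hM ↦ VanishAt.of_chains hfq hlift hsucc d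
          J i le_rfl hJq (fun l _ _ ↦ hd l) ⟨1, hq.one_notMem, hi i le_rfl⟩ hs M hM
    exact key n₂ _ (le_max_right _ _) (by lia) M
  by_cases hJt : J = ⊤
  · exact ⟨0, fun q hq hJq ↦ (hq.ne_top (top_le_iff.mp (hJt ▸ hJq))).elim⟩
  -- For J neither prime nor the unit ideal, V(J) is the union of the smaller closed sets V(J + (a))
  -- and V(J + (b)).
  obtain ⟨a, ha, b, hb, hab⟩ : ∃ a ∉ J, ∃ b ∉ J, a * b ∈ J := by
    by_contra! hcon
    refine hJ ⟨hJt, fun {a b} hab ↦ ?_⟩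
    by_contra! hne
    exact hcon a hne.1 b hne.2 hab
  have hlt (a : R) (ha : a ∉ J) : J < J ⊔ Ideal.span {a} := by
    refine lt_of_le_of_ne le_sup_left fun h ↦ ha ?_
    rw [h]
    exact Ideal.mem_sup_right (Ideal.mem_span_singleton_self a)
  obtain ⟨n₁, hn₁⟩ := ih _ (hlt a ha)
  obtain ⟨n₂, hn₂⟩ := ih _ (hlt b hb)
  refine ⟨max n₁ n₂, fun q hq hJq M _ _ _ ↦ ?_⟩
  obtain hq' | hq' := hq.mem_or_mem (hJq hab)
  · exact (hn₁ q hq (sup_le hJq ((Ideal.span_singleton_le_iff_mem q).mpr hq')) M).mono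
      (le_max_left _ _)
  · exact (hn₂ q hq (sup_le hJq ((Ideal.span_singleton_le_iff_mem q).mpr hq')) M).mono
      (le_max_right _ _)

end UniformBound

/-! ### Descent of Auslander regularity -/

section Assembly

variable {R A A' : Type u} [CommRing R] [Ring A] [Algebra R A] [Ring A'] [Algebra R A']

/-- The universal class dies in the localization, so one denominator kills it, and with it all
classes in Ext^i(M, Y) for all Y. -/
theorem vanishAt_of_forall_ext_eq_zero [IsNoetherianRing A] (q : Ideal R) [q.IsPrime]
    (φ : A →ₐ[R] A') [IsLocalizedModule q.primeCompl φ.toLinearMap] {i : ℕ}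
    (h : ∀ (M Y : ModuleCat.{u} A') (x : Ext M Y i), x = 0) (M : Type u) [AddCommGroup M]
    [Module A M] [Module.Finite A M] : VanishAt q A M i := by
  obtain ⟨K, F, j, η, hK, hF, hη⟩ := exists_universal_ext i (ModuleCat.of A M)
  obtain ⟨M', m, hm⟩ := exists_isLocMap q.primeCompl φ (ModuleCat.of A M)
  obtain ⟨K', ι, hι⟩ := exists_isLocMap q.primeCompl φ K
  obtain ⟨y, hy⟩ := (hm.bijective_ext q.primeCompl K' i).2
    (η.comp (Ext.mk₀ (toRes ι)) (add_zero i))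
  rw [h M' K' y, map_zero] at hy
  obtain ⟨s, hs, h1⟩ := hι.ext_inj q.primeCompl η hy.symm
  refine ⟨s, hs, fun Y z ↦ ?_⟩
  obtain ⟨g, rfl⟩ := (hη Y).1 z
  rw [← Ext.comp_assoc_of_third_deg_zero, mk₀_centralEnd_comp, h1, Ext.zero_comp]

variable [IsNoetherianRing R] [Module.Finite R A]

omit [IsNoetherianRing R] [Module.Finite R A] in
theorem isNoetherianRing_op_of_finite_algebra (R A : Type u) [CommRing R]
    [IsNoetherianRing R] [Ring A] [Algebra R A] [Module.Finite R A] : IsNoetherianRing Aᵐᵒᵖ :=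
  have : Module.Finite R Aᵐᵒᵖ := Module.Finite.equiv (MulOpposite.opLinearEquiv R : A ≃ₗ[R] Aᵐᵒᵖ)
  isNoetherianRing_of_finite_algebra (R := R)

omit [IsNoetherianRing R] [Module.Finite R A] in
theorem eq_top_of_forall_isPrime {J : Ideal R} (h : ∀ p : Ideal R, p.IsPrime → ∃ s ∉ p, s ∈ J) :
    J = ⊤ := by
  by_contra hJ
  obtain ⟨q, hq, hJq⟩ := Ideal.exists_le_maximal J hJ
  obtain ⟨s, hs, hsJ⟩ := h q hq.isPrime
  exact hs (hJq hsJ)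

omit [IsNoetherianRing R] [Module.Finite R A] in
theorem killsExt_one_of_forall_vanishAt {M : Type u} [AddCommGroup M] [Module A M] {i : ℕ}
    (h : ∀ q : Ideal R, q.IsPrime → VanishAt q A M i) : KillsExt A (1 : R) M i := by
  let J : Ideal R :=
    { carrier := {r | KillsExt A r M i}
      add_mem' := fun hr hs ↦ hr.add hs
      zero_mem' := killsExt_of_smul_eq_zero (by simp) i
      smul_mem' := fun c _ hr ↦ hr.mul_left c }
  exact (Ideal.eq_top_iff_one J).mp (eq_top_of_forall_isPrime h)

omit [IsNoetherianRing R] in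
theorem exists_krullDim_bound (h : ringKrullDim R ≠ ⊤) :
    ∃ d : ℕ, ∀ l : LTSeries (PrimeSpectrum R), l.length ≤ d := by
  obtain hb | ⟨d, hd⟩ : ringKrullDim R = ⊥ ∨ ∃ d : ℕ, ringKrullDim R = d := by
    match hr : ringKrullDim R with
    | ⊥ => exact .inl rfl
    | (d : ℕ∞) =>
      match d with
      | ⊤ => exact (h hr).elim
      | (d : ℕ) => exact .inr ⟨d, rfl⟩
  · refine ⟨0, fun l ↦ ?_⟩
    have := Order.LTSeries.length_le_krullDim l
    rw [ringKrullDim] at hb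
    rw [hb] at this
    simp at this
  · refine ⟨d, fun l ↦ ?_⟩
    have := Order.LTSeries.length_le_krullDim l
    rw [ringKrullDim] at hd
    rw [hd] at this
    exact_mod_cast this

theorem IsAuslanderRegular.of_forall_prime (hR : ringKrullDim R ≠ ⊤)
    {A' : PrimeSpectrum R → Type u} [∀ p, Ring (A' p)] [∀ p, Algebra R (A' p)]
    (φ : ∀ p, A →ₐ[R] A' p) [∀ p, IsLocalizedModule p.asIdeal.primeCompl (φ p).toLinearMap]
    (h : ∀ p, IsAuslanderRegular (A' p)) : IsAuslanderRegular A := by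
  have : IsNoetherianRing A := isNoetherianRing_of_finite_algebra (R := R)
  have := isNoetherianRing_op_of_finite_algebra R A
  have hS (J : Ideal R) (hJ : ∀ p : PrimeSpectrum R, ∃ s ∈ p.asIdeal.primeCompl, s ∈ J) : J = ⊤ :=
    eq_top_of_forall_isPrime fun p hp ↦ hJ ⟨p, hp⟩
  refine .mk' inferInstance (.of_forall _ φ hS fun p ↦ (h p).auslanderCondition) ?_
  obtain ⟨d, hd⟩ := exists_krullDim_bound hR
  obtain ⟨n, hn⟩ := exists_forall_vanishAt A d hd fun q hq ↦ by
    obtain ⟨n, hn⟩ := (h ⟨q, hq⟩).finite_globalDimension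
    have : IsLocalizedModule q.primeCompl (φ ⟨q, hq⟩).toLinearMap :=
      inferInstanceAs (IsLocalizedModule (PrimeSpectrum.asIdeal ⟨q, hq⟩).primeCompl _)
    exact ⟨n + 1, fun M _ _ _ ↦ vanishAt_of_forall_ext_eq_zero q (φ ⟨q, hq⟩)
      (fun M Y x ↦ x.eq_zero_of_hasProjectiveDimensionLT (n + 1) le_rfl) M⟩
  refine ⟨n, hasProjectiveDimensionLE_of_forall_finite n fun M _ Y x ↦ ?_⟩
  exact (killsExt_one_of_forall_vanishAt (R := R) fun q hq ↦ (hn q hq M).mono n.le_succ).eq_zero x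

theorem IsAuslanderRegular.of_span_eq_top (s : Finset R) (hs : Ideal.span (s : Set R) = ⊤)
    {A' : s → Type u} [∀ f, Ring (A' f)] [∀ f, Algebra R (A' f)]
    (φ : ∀ f, A →ₐ[R] A' f) [∀ f : s, IsLocalizedModule (.powers f.1) (φ f).toLinearMap]
    (h : ∀ f, IsAuslanderRegular (A' f)) : IsAuslanderRegular A := by
  have : IsNoetherianRing A := isNoetherianRing_of_finite_algebra (R := R)
  have := isNoetherianRing_op_of_finite_algebra R A
  have hS (J : Ideal R) (hJ : ∀ f : s, ∃ r ∈ Submonoid.powers (f : R), r ∈ J) : J = ⊤ := by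
    refine eq_top_of_forall_isPrime fun p hp ↦ ?_
    obtain ⟨f, hfs, hfp⟩ : ∃ f ∈ s, f ∉ p := by
      by_contra! hcon
      exact hp.ne_top (top_le_iff.mp (hs ▸ Ideal.span_le.mpr hcon))
    obtain ⟨_, ⟨n, rfl⟩, hr⟩ := hJ ⟨f, hfs⟩
    exact ⟨f ^ n, fun h ↦ hfp (hp.mem_of_pow_mem n h), hr⟩
  refine .mk' inferInstance (.of_forall _ φ hS fun p ↦ (h p).auslanderCondition) ?_
  choose n hn using fun f ↦ (h f).finite_globalDimension
  obtain ⟨N, hN⟩ : ∃ N, ∀ f, n f ≤ N :=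
    ⟨Finset.univ.sup n, fun f ↦ Finset.le_sup (Finset.mem_univ f)⟩
  exact ⟨N, hasProjectiveDimensionLE_of_forall _ φ hS N fun f M _ Y _ x ↦
    x.eq_zero_of_hasProjectiveDimensionLT (n f + 1) (by have := hN f; lia)⟩

omit [IsNoetherianRing R] [Module.Finite R A] in
theorem isLocalizedModule_includeLeft (S : Submonoid R) (B : Type u) [CommRing B] [Algebra R B]
    [IsLocalization S B] : IsLocalizedModule S
      (Algebra.TensorProduct.includeLeft : A →ₐ[R] A ⊗[R] B).toLinearMap :=
  inferInstanceAs (IsLocalizedModule S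
    ((TensorProduct.comm R B A).toLinearMap ∘ₗ TensorProduct.mk R B A 1))

/-- The localization map, as a homomorphism of algebras. -/
def localizedModuleMap (S : Submonoid R) (A : Type u) [Ring A] [Algebra R A] :
    A →ₐ[R] LocalizedModule S A :=
  AlgHom.ofLinearMap (LocalizedModule.mkLinearMap S A)
    (by simp [OreLocalization.one_def]) fun a b ↦ by
    simp only [LocalizedModule.mkLinearMap_apply, LocalizedModule.mk_mul_mk, one_mul]

instance (S : Submonoid R) : IsLocalizedModule S (localizedModuleMap S A).toLinearMap :=
  inferInstanceAs (IsLocalizedModule S (LocalizedModule.mkLinearMap S A))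

omit [IsNoetherianRing R] [Module.Finite R A] in
theorem exists_algHom_of_le {A₁ A₂ : Type u} [Ring A₁] [Algebra R A₁] [Ring A₂] [Algebra R A₂]
    {S₁ S₂ : Submonoid R} (hS : S₁ ≤ S₂) (φ₁ : A →ₐ[R] A₁) (φ₂ : A →ₐ[R] A₂)
    [IsLocalizedModule S₁ φ₁.toLinearMap] [IsLocalizedModule S₂ φ₂.toLinearMap] :
    ∃ ψ : A₁ →ₐ[R] A₂, IsLocalizedModule S₂ ψ.toLinearMap := by
  let l := IsLocalizedModule.liftOfLE S₁ S₂ hS φ₁.toLinearMap φ₂.toLinearMap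
  refine ⟨AlgHom.ofLinearMap l ?_ fun x y ↦ ?_, ?_⟩
  · have := IsLocalizedModule.liftOfLE_apply S₁ S₂ hS φ₁.toLinearMap φ₂.toLinearMap 1
    simpa using this
  · obtain ⟨⟨a, s⟩, rfl⟩ := IsLocalizedModule.mk'_surjective S₁ φ₁.toLinearMap x
    obtain ⟨⟨b, t⟩, rfl⟩ := IsLocalizedModule.mk'_surjective S₁ φ₁.toLinearMap y
    simp only [Function.uncurry, IsLocalizedModule.mk'_mul_mk', l, IsLocalizedModule.liftOfLE_mk']
    rfl
  · exact inferInstanceAs (IsLocalizedModule S₂ l)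

/-- A localization of a localization of a finite algebra inherits Auslander regularity. -/
theorem IsAuslanderRegular.of_le {A₁ A₂ : Type u} [Ring A₁] [Algebra R A₁] [Ring A₂]
    [Algebra R A₂] {S₁ S₂ : Submonoid R} (hS : S₁ ≤ S₂) (φ₁ : A →ₐ[R] A₁) (φ₂ : A →ₐ[R] A₂)
    [IsLocalizedModule S₁ φ₁.toLinearMap] [IsLocalizedModule S₂ φ₂.toLinearMap]
    (h : IsAuslanderRegular A₁) : IsAuslanderRegular A₂ := by
  have := isNoetherianRing_op_of_finite_algebra R A
  have := isLocalizedModule_op S₁ (φ := φ₁)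
  have := isNoetherianRing_of_isLocalizedModule S₁ (AlgHom.op φ₁)
  obtain ⟨ψ, _⟩ := exists_algHom_of_le hS φ₁ φ₂
  exact h.of_isLocalizedModule S₂ ψ

omit [IsNoetherianRing R] [Module.Finite R A] in
/-- A ring is left Noetherian if finitely many localizations that cover it are. -/
theorem isNoetherianRing_of_forall {κ : Type*} [Finite κ] (S : κ → Submonoid R) {A' : κ → Type u}
    [∀ k, Ring (A' k)] [∀ k, Algebra R (A' k)] (φ : ∀ k, A →ₐ[R] A' k)
    [∀ k, IsLocalizedModule (S k) (φ k).toLinearMap]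
    (hS : ∀ (N : Submodule A A) (x : A), (∀ k, ∃ s ∈ S k, algebraMap R A s • x ∈ N) → x ∈ N)
    [∀ k, IsNoetherianRing (A' k)] : IsNoetherianRing A := by
  refine ⟨fun I ↦ ?_⟩
  -- Finitely many generators of the localization of I at `S k` can be taken from I itself; every
  -- element of I then lies in their A-span up to a denominator. The union over k generates I.
  have key (k : κ) : ∃ T : Set A, T.Finite ∧ T ⊆ I ∧ ∀ x ∈ I, ∃ s ∈ S k,
      algebraMap R A s • x ∈ Submodule.span A T := by
    obtain ⟨T', hT', hspan⟩ := (Submodule.fg_span_iff_fg_span_finset_subset _).mp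
      (IsNoetherian.noetherian (Submodule.span (A' k) (selfMap (φ k) '' I)))
    classical
    obtain ⟨T, hTI, rfl⟩ := Finset.subset_set_image_iff.mp hT'
    refine ⟨T, T.finite_toSet, hTI, fun x hx ↦ ?_⟩
    have hx' : selfMap (φ k) x ∈
        Submodule.span (A' k) (selfMap (φ k) '' Submodule.span A (T : Set A)) := by
      have h1 := Submodule.subset_span (R := A' k) (Set.mem_image_of_mem (selfMap (φ k)) hx)
      rw [hspan, Finset.coe_image] at h1
      exact Submodule.span_mono (Set.image_mono Submodule.subset_span) h1
    obtain ⟨s, hs, y, hy, h⟩ := exists_denominator_of_mem_span (S k) (selfMap (φ k)) _ hx'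
    rw [← map_algebraMap_smul, ← sub_eq_zero, ← map_sub] at h
    obtain ⟨t, ht, h1⟩ := (isLocMap_selfMap (S k) (φ k)).inj _ h
    refine ⟨t * s, mul_mem ht hs, ?_⟩
    rw [smul_sub, sub_eq_zero, smul_smul, ← map_mul] at h1
    exact h1 ▸ Submodule.smul_mem _ _ hy
  choose T hTfin hTI hT using key
  have hspan : Submodule.span A (⋃ k, T k) = I := by
    refine le_antisymm (Submodule.span_le.mpr (Set.iUnion_subset hTI)) fun x hx ↦ ?_
    refine hS _ x fun k ↦ ?_
    obtain ⟨s, hs, h⟩ := hT k x hx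
    exact ⟨s, hs, Submodule.span_mono (Set.subset_iUnion T k) h⟩
  exact hspan ▸ Submodule.fg_span (Set.finite_iUnion hTfin)

end Assembly

/-! ### Sections over affine open subsets -/

section SheafSections

open PrimeSpectrum (basicOpen)

variable {R : Type u} (A : Type u) [CommRing R] [Ring A] [Algebra R A]
  {U V : Opens (PrimeSpectrum R)}

theorem mem_sheafSections_iff (s : Π p : U, LocalizedModule p.1.asIdeal.primeCompl A) :
    s ∈ sheafSections R A U ↔ (StructureSheaf.isLocallyFraction R A).pred s := by
  refine ⟨fun h p ↦ ?_, fun h p ↦ ?_⟩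
  · obtain ⟨V, hV, hVU, a, f, h⟩ := h p
    exact ⟨V, hV, homOfLE hVU, a, f, fun q ↦ h ⟨q.1, hVU q.2⟩ q.2⟩
  · obtain ⟨V, hV, i, a, f, h⟩ := h p
    exact ⟨V, hV, i.le, a, f, fun q hq ↦ h ⟨q.1, hq⟩⟩

/-- The sections of the sheaf of algebras, as sections of the sheaf of modules. -/
def sheafSectionsEquiv (U : Opens (PrimeSpectrum R)) :
    sheafSections R A U ≃ₗ[R] (structureSheafInType R A).obj.obj (Opposite.op U) where
  toFun s := ⟨s.1, (mem_sheafSections_iff A s.1).mp s.2⟩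
  invFun s := ⟨s.1, (mem_sheafSections_iff A s.1).mpr s.2⟩
  map_add' _ _ := rfl
  map_smul' _ _ := rfl
  left_inv _ := rfl
  right_inv _ := rfl

/-- The canonical homomorphism from an algebra to the sections of its sheaf. -/
def toSheafSections (U : Opens (PrimeSpectrum R)) : A →ₐ[R] sheafSections R A U :=
  (AlgHom.pi fun p : U ↦ localizedModuleMap p.1.asIdeal.primeCompl A).codRestrict _
    fun a p ↦ ⟨U, p.2, le_rfl, a, 1, fun _ _ ↦ ⟨one_mem _, rfl⟩⟩

instance isLocalizedModule_toSheafSections (f : R) :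
    IsLocalizedModule (.powers f) (toSheafSections A (basicOpen f)).toLinearMap :=
  inferInstanceAs (IsLocalizedModule (.powers f) ((sheafSectionsEquiv A _).symm.toLinearMap ∘ₗ
    StructureSheaf.toOpenₗ R A (basicOpen f)))

/-- The restriction of sections. -/
def restrictSections (h : V ≤ U) : sheafSections R A U →ₐ[R] sheafSections R A V :=
  AlgHom.codRestrict ((AlgHom.pi fun p : V ↦ Pi.evalAlgHom R
      (fun p : U ↦ LocalizedModule p.1.asIdeal.primeCompl A) ⟨p.1, h p.2⟩).comp
    (sheafSections R A U).val) _ fun s p ↦ by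
    obtain ⟨W, hW, -, a, f, hs⟩ := s.2 ⟨p.1, h p.2⟩
    exact ⟨W ⊓ V, ⟨hW, p.2⟩, inf_le_right, a, f, fun q hq ↦ hs ⟨q.1, h q.2⟩ hq.1⟩

theorem exists_basicOpen_fraction (s : sheafSections R A U) (p : U) : ∃ (g : R) (a : A)
    (_ : p.1 ∈ basicOpen g) (_ : basicOpen g ≤ U), ∀ (q : U) (hq : q.1 ∈ basicOpen g),
      s.1 q = LocalizedModule.mk a ⟨g, hq⟩ := by
  obtain ⟨g, hp, i, a, h⟩ := StructureSheaf.exists_const U (sheafSectionsEquiv A U s) p.1 p.2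
  exact ⟨g, a, hp, i, fun q hq ↦ congr(($h).1 ⟨q.1, hq⟩).symm⟩

variable [IsNoetherianRing R]

/-- Where s = a/g, the fraction vanishes on D(fg), so (fg)^n a = 0 and f^n s = 0 on D(g). Since U is
quasi-compact, one exponent suffices. -/
theorem exists_pow_smul_eq_zero (f : R) (h : basicOpen f ≤ U) (s : sheafSections R A U)
    (hs : restrictSections A h s = 0) : ∃ n, f ^ n • s = 0 := by
  have hloc (p : U) : ∃ n, ∃ g, p.1 ∈ basicOpen g ∧ ∀ q : U, q.1 ∈ basicOpen g →
      f ^ n • s.1 q = 0 := by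
    obtain ⟨g, a, hp, hgU, hg⟩ := exists_basicOpen_fraction A s p
    have h0 : toSheafSections A (basicOpen (f * g)) a = 0 := by
      refine Subtype.ext (funext fun q ↦ ?_)
      have hqf : q.1 ∈ basicOpen f := PrimeSpectrum.basicOpen_mul_le_left f g q.2
      have hqg : q.1 ∈ basicOpen g := PrimeSpectrum.basicOpen_mul_le_right f g q.2
      have h1 : LocalizedModule.mk a (⟨g, hqg⟩ : q.1.asIdeal.primeCompl) = 0 :=
        (hg ⟨q.1, h hqf⟩ hqg).symm.trans congr(($hs).1 ⟨q.1, hqf⟩)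
      rw [← LocalizedModule.zero_mk 1, LocalizedModule.mk_eq] at h1
      obtain ⟨u, hu⟩ := h1
      refine Eq.trans (LocalizedModule.mk_eq.mpr ⟨u, ?_⟩) (LocalizedModule.zero_mk 1)
      simp only [hu, smul_zero]
    obtain ⟨⟨_, n, rfl⟩, hn⟩ := (IsLocalizedModule.eq_zero_iff (.powers (f * g))
      (toSheafSections A (basicOpen (f * g))).toLinearMap).mp h0
    refine ⟨n, g, hp, fun q hq ↦ ?_⟩
    rw [hg q hq, LocalizedModule.smul'_mk, ← LocalizedModule.zero_mk 1, LocalizedModule.mk_eq]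
    refine ⟨⟨g, hq⟩ ^ n, ?_⟩
    rw [one_smul, smul_zero, smul_zero]
    change g ^ n • f ^ n • a = 0
    rw [smul_smul, ← mul_pow, mul_comm]
    exact hn
  have hcomp := TopologicalSpace.NoetherianSpace.isCompact (U : Set (PrimeSpectrum R))
  obtain ⟨n, hn⟩ : ∃ n, ∀ q : U, q.1 ∈ (U : Set (PrimeSpectrum R)) → f ^ n • s.1 q = 0 := by
    refine hcomp.induction_on (p := fun K ↦ ∃ n, ∀ q : U, q.1 ∈ K → f ^ n • s.1 q = 0)
      ⟨0, fun q hq ↦ hq.elim⟩ (fun K L hKL ⟨n, hn⟩ ↦ ⟨n, fun q hq ↦ hn q (hKL hq)⟩)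
      (fun K L ⟨n, hn⟩ ⟨m, hm⟩ ↦ ⟨n + m, fun q hq ↦ ?_⟩) fun p hp ↦ ?_
    · obtain hq | hq := hq
      · rw [add_comm, pow_add, mul_smul, hn q hq, smul_zero]
      · rw [pow_add, mul_smul, hm q hq, smul_zero]
    · obtain ⟨n, g, hpg, hg⟩ := hloc ⟨p, hp⟩
      exact ⟨basicOpen g, mem_nhdsWithin_of_mem_nhds ((basicOpen g).isOpen.mem_nhds hpg), n, hg⟩
  exact ⟨n, Subtype.ext (funext fun q ↦ hn q q.2)⟩

/-- Surjectivity is inherited from A, as every section over D(f) is already a fraction with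
numerator in A; only the vanishing of sections needs an argument on U. -/
theorem isLocalizedModule_restrictSections (f : R) (h : basicOpen f ≤ U) :
    IsLocalizedModule (.powers f) (restrictSections A h).toLinearMap where
  map_units := IsLocalizedModule.map_units (toSheafSections A (basicOpen f)).toLinearMap
  surj y := by
    obtain ⟨⟨a, s⟩, ha⟩ := IsLocalizedModule.surj (.powers f)
      (toSheafSections A (basicOpen f)).toLinearMap y
    exact ⟨⟨toSheafSections A U a, s⟩, ha⟩
  exists_of_eq {s t} hst := by
    obtain ⟨n, hn⟩ := exists_pow_smul_eq_zero A f h (s - t)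
      ((map_sub _ s t).trans (sub_eq_zero.mpr hst))
    exact ⟨⟨f ^ n, n, rfl⟩, sub_eq_zero.mp ((smul_sub (f ^ n) s t).symm.trans hn)⟩

omit [IsNoetherianRing R] in
-- Scalars act by right multiplication, hence preserve right ideals of the ring of sections.
theorem localization_smul_eq_mul (S : Submonoid R) (c : Localization S) (x : LocalizedModule S A) :
    c • x = x * (c • (1 : LocalizedModule S A)) := by
  induction c using Localization.induction_on with | H c =>
  induction x using LocalizedModule.induction_on with | h a t =>
  rw [OreLocalization.one_def]
  change Localization.mk c.1 c.2 • LocalizedModule.mk a t =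
    LocalizedModule.mk a t * (Localization.mk c.1 c.2 • LocalizedModule.mk 1 1)
  rw [LocalizedModule.mk_smul_mk, LocalizedModule.mk_smul_mk, LocalizedModule.mk_mul_mk,
    mul_smul_comm, mul_one, mul_one, mul_comm c.2 t]

section SectionSMul

variable (c d : (structureSheafInType R R).obj.obj (Opposite.op U)) (x : sheafSections R A U)

/-- Sections of the structure sheaf act on the sections of the sheaf of algebras. -/
def sectionSMul : sheafSections R A U :=
  (sheafSectionsEquiv A U).symm (c • sheafSectionsEquiv A U x)

omit [IsNoetherianRing R]

theorem sectionSMul_eq_mul : sectionSMul A c x = x * sectionSMul A c 1 :=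
  Subtype.ext (funext fun _ ↦ localization_smul_eq_mul A _ _ _)

theorem sectionSMul_add : sectionSMul A (c + d) x = sectionSMul A c x + sectionSMul A d x :=
  (congrArg _ (add_smul c d _)).trans (map_add _ _ _)

theorem sectionSMul_zero : sectionSMul A (0 : (structureSheafInType R R).obj.obj _) x = 0 := by
  have h := sectionSMul_add A 0 0 x
  rwa [add_zero, left_eq_add] at h

theorem sectionSMul_one : sectionSMul A (1 : (structureSheafInType R R).obj.obj _) x = x :=
  (congrArg _ (one_smul _ _)).trans (LinearEquiv.symm_apply_apply _ _)

theorem sectionSMul_mul : sectionSMul A (c * d) x = sectionSMul A d x * sectionSMul A c 1 :=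
  have h : sectionSMul A (c * d) x = sectionSMul A c (sectionSMul A d x) :=
    Subtype.ext (funext fun p ↦ SemigroupAction.mul_smul
      (α := Localization p.1.asIdeal.primeCompl) (c.1 p) (d.1 p) (x.1 p))
  h.trans (sectionSMul_eq_mul A c (sectionSMul A d x))

theorem sectionSMul_algebraMap (r : R) : sectionSMul A (algebraMap R _ r) x = r • x :=
  (congrArg (sheafSectionsEquiv A U).symm (algebraMap_smul _ r _)).trans
    ((sheafSectionsEquiv A U).symm_apply_apply (r • x))

end SectionSMul

/-- The ring of sections is not known to be finite over R, so right Noetherianity is descended from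
the rings over D(f). The f in T generate the unit ideal only among functions on U, so membership in
a right ideal N is tested with the ideal of functions c such that cx lies in N. -/
theorem isNoetherianRing_op_sheafSections_of_span [Module.Finite R A] (T : Finset R)
    (hTU : ∀ f ∈ T, basicOpen f ≤ U) (hspan : Ideal.span ((fun f ↦
      algebraMap R ((structureSheafInType R R).obj.obj (Opposite.op U)) f) '' T) = ⊤) :
    IsNoetherianRing (sheafSections R A U)ᵐᵒᵖ := by
  let φ (f : T) := restrictSections A (hTU f.1 f.2)
  have h1 (f : T) : IsLocalizedModule (.powers f.1) (φ f).toLinearMap :=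
    isLocalizedModule_restrictSections A f.1 (hTU f.1 f.2)
  have h2 (f : T) : IsLocalizedModule (.powers f.1) (AlgHom.op (φ f)).toLinearMap :=
    isLocalizedModule_op (.powers f.1) (φ := φ f)
  have h3 (f : T) : IsNoetherianRing (sheafSections R A (basicOpen f.1))ᵐᵒᵖ :=
    have := isNoetherianRing_op_of_finite_algebra R A
    have := isLocalizedModule_op (.powers f.1) (φ := toSheafSections A (basicOpen f.1))
    isNoetherianRing_of_isLocalizedModule (.powers f.1)
      (AlgHom.op (toSheafSections A (basicOpen f.1)))
  refine isNoetherianRing_of_forall (fun f : T ↦ .powers f.1) (fun f : T ↦ AlgHom.op (φ f))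
    fun N x hx ↦ ?_
  let J : Ideal ((structureSheafInType R R).obj.obj (Opposite.op U)) :=
    { carrier := {c | MulOpposite.op (sectionSMul A c x.unop) ∈ N}
      add_mem' := fun {c d} hc hd ↦ by
        rw [Set.mem_ofPred_eq, sectionSMul_add]
        exact N.add_mem hc hd
      zero_mem' := by
        rw [Set.mem_ofPred_eq, sectionSMul_zero]
        exact N.zero_mem
      smul_mem' := fun c d hd ↦ by
        rw [Set.mem_ofPred_eq, smul_eq_mul, sectionSMul_mul]
        exact N.smul_mem (MulOpposite.op (sectionSMul A c 1)) hd }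
  -- Only powers of the f in T are known to lie in J, hence the radical.
  have hJ : J.radical = ⊤ := by
    refine top_le_iff.mp (hspan ▸ Ideal.span_le.mpr ?_)
    rintro _ ⟨f, hf, rfl⟩
    obtain ⟨_, ⟨n, rfl⟩, hn⟩ := hx ⟨f, hf⟩
    refine ⟨n, ?_⟩
    change MulOpposite.op (sectionSMul A (algebraMap R _ f ^ n) x.unop) ∈ N
    rw [← map_pow, sectionSMul_algebraMap]
    rw [smul_eq_mul, ← Algebra.smul_def] at hn
    exact hn
  have h4 : MulOpposite.op (sectionSMul A 1 x.unop) ∈ N :=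
    (Ideal.eq_top_iff_one J).mp (Ideal.radical_eq_top.mp hJ)
  rwa [sectionSMul_one] at h4

omit [IsNoetherianRing R] in
-- The basic opens of Spec R inside U cover U; as U is affine, the functions defining them generate
-- the unit ideal.
theorem span_algebraMap_eq_top {U : (Spec (CommRingCat.of R)).Opens} (hU : IsAffineOpen U) :
    Ideal.span ((fun f ↦ algebraMap R ((structureSheafInType R R).obj.obj (Opposite.op U)) f) ''
      {f : R | basicOpen f ≤ U}) = ⊤ := by
  let X := Spec (CommRingCat.of R)
  let s : Set Γ(X, U) := (fun f ↦ X.presheaf.map (homOfLE (le_top : U ≤ ⊤)).op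
    ((Scheme.ΓSpecIso (CommRingCat.of R)).inv f)) '' {f : R | basicOpen f ≤ U}
  refine (hU.self_le_iSup_basicOpen_iff (s := s)).mp fun x hx ↦ ?_
  obtain ⟨_, ⟨_, ⟨f, rfl⟩, rfl⟩, hxf, hfU⟩ :=
    PrimeSpectrum.isBasis_basic_opens.exists_subset_of_mem_open hx U.2
  refine Opens.mem_iSup.mpr ⟨⟨_, f, hfU, rfl⟩, ?_⟩
  rw [Scheme.basicOpen_res, basicOpen_eq_of_affine]
  exact ⟨hx, hxf⟩

theorem isNoetherianRing_op_sheafSections [Module.Finite R A]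
    {U : (Spec (CommRingCat.of R)).Opens} (hU : IsAffineOpen U) :
    IsNoetherianRing (sheafSections R A U)ᵐᵒᵖ := by
  obtain ⟨T, hT, hspan⟩ := (Ideal.span_eq_top_iff_finite _).mp (span_algebraMap_eq_top hU)
  classical
  obtain ⟨T, hTU, rfl⟩ := Finset.subset_set_image_iff.mp hT
  exact isNoetherianRing_op_sheafSections_of_span A T hTU (by rwa [Finset.coe_image] at hspan)

/-- The sections over a basic open subset of an affine open subset inherit Auslander regularity. -/
theorem IsAuslanderRegular.basicOpen_of_sheafSections [Module.Finite R A]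
    {U : (Spec (CommRingCat.of R)).Opens} (hU : IsAffineOpen U) {f : R} (hf : basicOpen f ≤ U)
    (h : IsAuslanderRegular (sheafSections R A U)) :
    IsAuslanderRegular (LocalizedModule (.powers f) A) := by
  have := isNoetherianRing_op_sheafSections A hU
  have := isLocalizedModule_restrictSections A f hf
  exact (h.of_isLocalizedModule (.powers f) (restrictSections A hf)).of_le
    (S₁ := .powers f) (S₂ := .powers f) le_rfl
    (toSheafSections A (basicOpen f)) (localizedModuleMap (.powers f) A)

omit [IsNoetherianRing R] in
theorem isLocalizedModule_toSheafSections_top :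
    IsLocalizedModule (.powers (1 : R))
      (toSheafSections A (⊤ : Opens (PrimeSpectrum R))).toLinearMap := by
  rw [← PrimeSpectrum.basicOpen_one]
  infer_instance

end SheafSections

/-! ### Krull dimension of finitely generated algebras -/

section FiniteType

theorem ringKrullDim_ne_top_of_finiteType (k : Type v) (R : Type u) [Field k] [CommRing R]
    [Algebra k R] (h : Algebra.FiniteType k R) : ringKrullDim R ≠ ⊤ := by
  obtain ⟨n, f, hf⟩ := Algebra.FiniteType.iff_quotient_mvPolynomial''.mp h
  have h1 := ringKrullDim_le_of_surjective f.toRingHom hf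
  rw [MvPolynomial.ringKrullDim_of_isNoetherianRing, ringKrullDim_eq_zero_of_field, zero_add] at h1
  rintro h2
  rw [h2, top_le_iff] at h1
  simp only [Nat.card_eq_fintype_card, Fintype.card_fin] at h1
  exact absurd h1 (WithBot.coe_injective.ne (ENat.natCast_ne_top n))

end FiniteType

end AuslanderTheory

end

/-! ### The main theorem -/

theorem mainTheorem6 (R A : Type u) [CommRing R] [IsNoetherianRing R] [Ring A] [Algebra R A]
    [Module.Finite R A] (hRA : Function.Injective (algebraMap R A)) :
    List.TFAE
      [AuslanderTheory.IsAuslanderRegular A,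
        ∃ 𝒰 : Set (Spec (CommRingCat.of R)).Opens, sSup 𝒰 = ⊤ ∧
          ∀ U ∈ 𝒰, IsAffineOpen U ∧
            AuslanderTheory.IsAuslanderRegular (AuslanderTheory.sheafSections R A U),
        ∃ s : Finset R, PrimeSpectrum.zeroLocus (s : Set R) = ∅ ∧
          ∀ f ∈ s, AuslanderTheory.IsAuslanderRegular (LocalizedModule (Submonoid.powers f) A)] ∧
    (AuslanderTheory.IsAuslanderRegular A →
      ∀ (p : Ideal R) [p.IsPrime],
        AuslanderTheory.IsAuslanderRegular (A ⊗[R] Localization.AtPrime p)) ∧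
    (ringKrullDim R ≠ ⊤ →
      (∀ (p : Ideal R) [p.IsPrime],
        AuslanderTheory.IsAuslanderRegular (A ⊗[R] Localization.AtPrime p)) →
      AuslanderTheory.IsAuslanderRegular A) ∧
    (∀ (k : Type v) [Field k] [Algebra k R], Algebra.FiniteType k R →
      List.TFAE
        [AuslanderTheory.IsAuslanderRegular A,
          ∀ (p : Ideal R) [p.IsPrime],
            AuslanderTheory.IsAuslanderRegular (A ⊗[R] Localization.AtPrime p),
          ∀ (m : Ideal R) [m.IsMaximal],
            AuslanderTheory.IsAuslanderRegular (A ⊗[R] Localization.AtPrime m)]) := by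
  have hloc (p : Ideal R) [p.IsPrime] : IsLocalizedModule p.primeCompl
      (Algebra.TensorProduct.includeLeft : A →ₐ[R] A ⊗[R] Localization.AtPrime p).toLinearMap :=
    AuslanderTheory.isLocalizedModule_includeLeft p.primeCompl _
  have := AuslanderTheory.isNoetherianRing_op_of_finite_algebra R A
  have h14 (h : AuslanderTheory.IsAuslanderRegular A) (p : Ideal R) [p.IsPrime] :
      AuslanderTheory.IsAuslanderRegular (A ⊗[R] Localization.AtPrime p) :=
    h.of_isLocalizedModule p.primeCompl Algebra.TensorProduct.includeLeft
  have h41 (hR : ringKrullDim R ≠ ⊤) (h : ∀ (p : Ideal R) [p.IsPrime],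
      AuslanderTheory.IsAuslanderRegular (A ⊗[R] Localization.AtPrime p)) :
      AuslanderTheory.IsAuslanderRegular A :=
    have (p : PrimeSpectrum R) := hloc p.asIdeal
    .of_forall_prime hR (A' := fun p ↦ A ⊗[R] Localization.AtPrime p.asIdeal)
      (fun p ↦ Algebra.TensorProduct.includeLeft) fun p ↦ h p.asIdeal
  refine ⟨?_, h14, h41, fun k _ _ hk ↦ ?_⟩
  · tfae_have 1 → 2 := fun h ↦
      have := AuslanderTheory.isLocalizedModule_toSheafSections_top (R := R) A
      ⟨{⊤}, sSup_singleton, fun U hU ↦ by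
        obtain rfl := Set.mem_singleton_iff.mp hU
        exact ⟨isAffineOpen_top _, @AuslanderTheory.IsAuslanderRegular.of_isLocalizedModule R A
          _ _ _ _ _ _ ‹_› (.powers (1 : R)) (AuslanderTheory.toSheafSections A ⊤) this h⟩⟩
    tfae_have 2 → 3 := fun ⟨𝒰, h𝒰, h⟩ ↦ by
      let F : Set R := {f | AuslanderTheory.IsAuslanderRegular
        (LocalizedModule (Submonoid.powers f) A)}
      -- Every prime lies in some D(f) contained in a member of the cover, and regularity passes
      -- from the sections over that member to D(f).
      have hF : Ideal.span F = ⊤ := AuslanderTheory.eq_top_of_forall_isPrime fun p hp ↦ by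
        have hx : (⟨p, hp⟩ : PrimeSpectrum R) ∈ sSup 𝒰 := h𝒰 ▸ Opens.mem_top _
        obtain ⟨U, hU, hx⟩ := Opens.mem_sSup.mp hx
        obtain ⟨_, ⟨_, ⟨f, rfl⟩, rfl⟩, hpf, hfU⟩ :=
          PrimeSpectrum.isBasis_basic_opens.exists_subset_of_mem_open hx U.2
        exact ⟨f, hpf, Ideal.subset_span ((h U hU).2.basicOpen_of_sheafSections A (h U hU).1 hfU)⟩
      obtain ⟨s, hs, hspan⟩ := (Ideal.span_eq_top_iff_finite F).mp hF
      exact ⟨s, by rw [← PrimeSpectrum.zeroLocus_span, hspan,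
          PrimeSpectrum.zeroLocus_empty_iff_eq_top],
        fun f hf ↦ hs hf⟩
    tfae_have 3 → 1 := fun ⟨s, hs, h⟩ ↦ by
      rw [← PrimeSpectrum.zeroLocus_span, PrimeSpectrum.zeroLocus_empty_iff_eq_top] at hs
      exact .of_span_eq_top s hs
        (fun f ↦ AuslanderTheory.localizedModuleMap (.powers f.1) A) fun f ↦ h f.1 f.2
    tfae_finish
  · have hR : ringKrullDim R ≠ ⊤ := AuslanderTheory.ringKrullDim_ne_top_of_finiteType k R hk
    tfae_have 1 → 3 := fun h m hm ↦ h14 h m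
    -- Choose a maximal ideal m containing p; inverting more elements turns A_m into A_p.
    tfae_have 3 → 2 := fun h p hp ↦ by
      obtain ⟨m, hm, hpm⟩ := Ideal.exists_le_maximal p hp.ne_top
      exact (h m).of_le (S₁ := m.primeCompl) (S₂ := p.primeCompl) (fun s hs hsp ↦ hs (hpm hsp))
        (Algebra.TensorProduct.includeLeft : A →ₐ[R] _) Algebra.TensorProduct.includeLeft
    tfae_have 2 → 1 := h41 hR
    tfae_finish
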